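/- **Conventions.** A *cell complex* below is a finite regular one, a *subcomplex* is given by its cells, and a complex $K$ *collapses onto* a subcomplex $L$ if $L$ is obtained from $K$ by finitely many elementary collapses, each of which deletes two cells $\sigma\subsetneq\tau$ where $\tau$ is the only remaining cell that properly contains $\sigma$. **Torus fronts.** Let $b,m,n$ be positive integers and let $g$ be a natural number. An $(m,n)$-grid path is a directed path with steps $(1,0)$ (eastbound) and $(0,1)$ (northbound) from $(-x,x)$ to $(m-x,n+x)$ for some integer $x$; it is identified with the bi-infinite path invariant under translation by $(m,n)$ that it generates. A $b$-band $(m,n)$-torus front is an orbit of such paths under translation by multiples of $(-b,b)$. A northwestern (southeastern) sharp corner is a vertex entered by a northbound (eastbound) edge and left by an eastbound (northbound) edge. An elementary flip exchanges a northwestern sharp corner at $(a,c)$ with a southeastern sharp corner at $(a+1,c-1)$ (together with its translates by multiples of $(m,n)$). A flip is a (possibly empty) collection of elementary flips at sharp corners of a front that are pairwise at distance at least $2$ along the front; its members are the fronts obtained by choosing one of the two positions for each flipped corner. The cells of the cubical complex $TF^b_{m,n,g}$ are the flips all of whose members have only horizontal legs with at least $g$ vertices (a single vertex between two consecutive northbound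 edges is a leg with one vertex); faces are given by inclusion of flips, the vertices are the flips with a single member. The width of a front is the distance, measured along the line $x=-y$, between the two lines parallel to the line through $(0,0)$ and $(m,n)$ that are tangent to the path from the northwest and from the southeast. The width of a flip is the maximal width of its members. A front or flip is thin if its width is at most $\sqrt2$. **Cycle maps.** Let $m\ge 5$, $n\ge 3$, $n\ne 4$. The cells of $\mathrm{Hom}(C_m,C_n)$ are the products $\prod_{x\in V(C_m)}\sigma_x$ of simplices with $\emptyset\neq\sigma_x\subseteq V(C_n)$ such that $\sigma_x\times\sigma_y\subseteq E(C_n)$ whenever $(x,y)\in E(C_m)$; its vertices are the graph homomorphisms $C_m\to C_n$. For an integer $w\ge 0$ let $X_w$ be the subcomplex of $\mathrm{Hom}(C_m,C_n)$ of all cells all of whose vertices have winding number $w$. Suppose that $r=(m-nw)/2$ is a positive integer. A homomorphism with winding number $w$ makes $m-r$ forward steps and $r$ backward steps along $C_n$; reading forward steps as northbound and backward steps as eastbound edges, it is encoded by a bi-infinite $(r,m-r)$-invariant grid path, unique up to translation by multiples of $(-1,1)$. The thin part of $X_w$ consists of the cells all of whose vertices are encoded by thin paths. **Theorem.** 1.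 For all positive integers $b,m,n$ and every natural number $g$, the complex $TF^b_{m,n,g}$ collapses onto its subcomplex of all thin $b$-band flips. 2. Let $m\ge5$, $n\ge3$, $n\ne4$, $w\ge0$ be integers such that $r=(m-nw)/2$ is a positive integer. Then $X_w$ collapses onto its thin part. The thin part is the union (with all faces) of $mn/\gcd(m,r)$ cubes of dimension $\gcd(m,r)$, which are linked at opposite vertices into two disjoint circles if $m$ and $n$ are both even, and into one circle otherwise; that is, in each circle every cube meets its predecessor and its successor each in a single vertex, these two vertices being opposite in the cube, and there are no other intersections among the cubes. -/

import Mathlib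

/-! ## Collapses

A finite regular cell complex is handled through its face poset; a subcomplex is a set of cells. -/

/-- An elementary collapse of the complex `K` onto `L`: the cell `σ` of `K` is a proper face of
exactly one cell of `K`, namely `τ`, and `L` is obtained from `K` by deleting `σ` and `τ`.
If `K` is closed under faces, then `τ` is maximal in `K`, `σ` has codimension one in `τ`, and `L`
is again closed under faces. -/
def ElementaryCollapse {C : Type*} [PartialOrder C] (K L : Set C) : Prop :=
  ∃ σ ∈ K, ∃ τ ∈ K, σ < τ ∧ (∀ ρ ∈ K, σ < ρ → ρ = τ) ∧ L = K \ {σ, τ}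

/-- `K` collapses onto `L` if a finite sequence of elementary collapses leads from `K` to `L`. -/
def CollapsesTo {C : Type*} [PartialOrder C] (K L : Set C) : Prop :=
  Relation.ReflTransGen ElementaryCollapse K L

/-! ## Band torus fronts -/

/-- A bi-infinite directed grid path in the plane, using the steps `(1, 0)` and `(0, 1)` and
invariant under translation by the vector `(m, n)`. It is given by its second coordinate `y`: the
vertex of the path on the line `x + y = t` is `(t - y t, y t)`. Such a path is the same as the union
of the translates, by the multiples of `(m, n)`, of an `(m, n)`-grid path from a point
`(-x, x)` to the point `(m - x, n + x)`, where `x = y 0`. -/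
@[ext] structure GridPath (m n : ℕ) where
  y : ℤ → ℤ
  step : ∀ t, y (t + 1) = y t ∨ y (t + 1) = y t + 1
  periodic : ∀ t, y (t + (m + n)) = y t + n

namespace GridPath

variable {m n : ℕ}

/-- Translation of a path by the vector `(-k, k)`. -/
def shift (p : GridPath m n) (k : ℤ) : GridPath m n where
  y t := p.y t + k
  step t := by
    rcases p.step t with h | h
    · left; omega
    · right; omega
  periodic t := by have := p.periodic t; omega

/-- All horizontal legs have length at least `g`, the length being the number of vertices. A leg
starts right after a northbound edge, and a leg with a single vertex, between two consecutive
northbound edges, counts as well. -/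
def LegsAtLeast (g : ℕ) (p : GridPath m n) : Prop :=
  ∀ t, p.y (t + 1) = p.y t + 1 → ∀ k : ℕ, 1 ≤ k → k ≤ g → p.y (t + k) = p.y (t + 1)

/-- The line through the vertex `(t - y t, y t)` of the path which is parallel to the line through
`(0, 0)` and `(m, n)` meets the line `x = -y` in the point `(-c, c)`, where `c` is
`p.offset t`. -/
noncomputable def offset (p : GridPath m n) (t : ℤ) : ℝ :=
  ((m : ℝ) * (p.y t : ℝ) - (n : ℝ) * ((t : ℝ) - (p.y t : ℝ))) / ((m : ℝ) + (n : ℝ))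

/-- The width: the distance, measured along the line `x = -y`, between the two lines parallel to
the line through `(0, 0)` and `(m, n)` that are tangent to the path from the northwest
and from the southeast. -/
noncomputable def width (p : GridPath m n) : ℝ :=
  Real.sqrt 2 * ((⨆ t, p.offset t) - (⨅ t, p.offset t))

/-- The path is thin. -/
def Thin (p : GridPath m n) : Prop := p.width ≤ Real.sqrt 2

end GridPath

/-- A flip of a grid path: a collection of pairwise non-interfering elementary flips, each of which
exchanges a northwestern sharp corner at `(a, b)` with a southeastern one at `(a + 1, b - 1)`.
It is recorded by the two paths in which all flipped corners are in the northwestern position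
(`top`), respectively in the southeastern position (`bot`). A flip in which no corner is flipped is
a single path. -/
@[ext] structure GridFlip (m n : ℕ) where
  top : GridPath m n
  bot : GridPath m n
  /-- A flipped vertex is a northwestern sharp corner of `top`, entered by a northbound and left by
  an eastbound edge, and it moves by `(1, -1)`. -/
  elementary : ∀ t, bot.y t ≠ top.y t →
    bot.y t = top.y t - 1 ∧ top.y t = top.y (t - 1) + 1 ∧ top.y (t + 1) = top.y t
  /-- Flipped vertices are at distance at least two along the path. -/
  apart : ∀ t, bot.y t ≠ top.y t → bot.y (t + 1) = top.y (t + 1)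

namespace GridFlip

variable {m n : ℕ}

/-- The members of a flip: the paths obtained by choosing one of the two positions for each
flipped corner. -/
def Member (F : GridFlip m n) (p : GridPath m n) : Prop :=
  ∀ t, p.y t = F.top.y t ∨ p.y t = F.bot.y t

theorem bot_le (F : GridFlip m n) (t : ℤ) : F.bot.y t ≤ F.top.y t := by
  by_cases h : F.bot.y t = F.top.y t
  · exact h.le
  · have := (F.elementary t h).1; omega

theorem member_top (F : GridFlip m n) : F.Member F.top := fun _ => Or.inl rfl

theorem member_bot (F : GridFlip m n) : F.Member F.bot := fun _ => Or.inr rfl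

/-- `F` is a face of `G` if all members of `F` are members of `G`. -/
instance : LE (GridFlip m n) := ⟨fun F G => ∀ p, F.Member p → G.Member p⟩

theorem le_def {F G : GridFlip m n} : F ≤ G ↔ ∀ p, F.Member p → G.Member p := Iff.rfl

theorem top_le {F G : GridFlip m n} (h : F ≤ G) (t : ℤ) : F.top.y t ≤ G.top.y t := by
  have h1 := h _ F.member_top t
  have h2 := G.bot_le t
  omega

theorem le_bot {F G : GridFlip m n} (h : F ≤ G) (t : ℤ) : G.bot.y t ≤ F.bot.y t := by
  have h1 := h _ F.member_bot t
  have h2 := G.bot_le t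
  omega

/-- Translation of a flip by the vector `(-k, k)`. -/
def shift (F : GridFlip m n) (k : ℤ) : GridFlip m n where
  top := F.top.shift k
  bot := F.bot.shift k
  elementary t h := by
    simp only [GridPath.shift] at h ⊢
    have := F.elementary t (by omega)
    omega
  apart t h := by
    simp only [GridPath.shift] at h ⊢
    have := F.apart t (by omega)
    omega

theorem shift_zero (F : GridFlip m n) : F.shift 0 = F := by
  ext t <;> simp [shift, GridPath.shift]

theorem shift_shift (F : GridFlip m n) (k l : ℤ) : (F.shift k).shift l = F.shift (k + l) := by
  ext t <;> simp [shift, GridPath.shift, add_assoc]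

theorem shift_le_shift {F G : GridFlip m n} (h : F ≤ G) (k : ℤ) : F.shift k ≤ G.shift k := by
  intro p hp t
  have h1 : F.Member (p.shift (-k)) := by
    intro s
    have := hp s
    simp only [shift, GridPath.shift] at this ⊢
    omega
  have := h _ h1 t
  simp only [shift, GridPath.shift] at this ⊢
  omega

theorem le_antisymm' {F G : GridFlip m n} (h : F ≤ G) (h' : G ≤ F) : F = G := by
  ext t
  · exact le_antisymm (top_le h t) (top_le h' t)
  · exact le_antisymm (le_bot h' t) (le_bot h t)

/-- Two flips are identified if they differ by a translation by a multiple of `(-b, b)`. -/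
def bandSetoid (b m n : ℕ) : Setoid (GridFlip m n) where
  r F G := ∃ k : ℤ, F.shift (k * b) = G
  iseqv :=
    { refl := fun F => ⟨0, by simp [shift_zero]⟩
      symm := by
        rintro F _ ⟨k, rfl⟩
        exact ⟨-k, by rw [shift_shift]; simp [shift_zero]⟩
      trans := by
        rintro F _ _ ⟨k, rfl⟩ ⟨l, rfl⟩
        exact ⟨k + l, by rw [shift_shift, add_mul]⟩ }

end GridFlip

/-- The flips of `b`-band `(m, n)`-torus fronts: orbits of flips of `(m, n)`-invariant grid paths
under translation by multiples of `(-b, b)`. The orbits of flips without flipped corners are the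
`b`-band `(m, n)`-torus fronts themselves. -/
def BandFlip (b m n : ℕ) : Type := Quotient (GridFlip.bandSetoid b m n)

namespace BandFlip

variable {b m n : ℕ}

/-- The orbit of a flip. -/
def mk (b : ℕ) {m n : ℕ} (F : GridFlip m n) : BandFlip b m n :=
  Quotient.mk (GridFlip.bandSetoid b m n) F

theorem mk_eq_mk {F G : GridFlip m n} : mk b F = mk b G ↔ ∃ k : ℤ, F.shift (k * b) = G :=
  Quotient.eq (r := GridFlip.bandSetoid b m n)

theorem mk_surjective (c : BandFlip b m n) : ∃ F, mk b F = c := Quotient.exists_rep c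

/-- The face relation on orbits of flips. -/
instance : PartialOrder (BandFlip b m n) where
  le c d := ∃ F G : GridFlip m n, mk b F = c ∧ mk b G = d ∧ F ≤ G
  le_refl c := by
    obtain ⟨F, rfl⟩ := mk_surjective c
    exact ⟨F, F, rfl, rfl, fun _ h => h⟩
  le_trans := by
    rintro _ _ _ ⟨F, G, rfl, rfl, h⟩ ⟨G', H, hG, rfl, h'⟩
    obtain ⟨k, rfl⟩ := mk_eq_mk.1 hG
    refine ⟨F, H.shift (k * b), rfl, (mk_eq_mk.2 ⟨k, rfl⟩).symm, ?_⟩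
    intro p hp
    exact GridFlip.shift_le_shift h' _ p (h p hp)
  le_antisymm := by
    rintro _ _ ⟨F, G, rfl, rfl, h⟩ ⟨G', F', hG, hF, h'⟩
    obtain ⟨k, rfl⟩ := mk_eq_mk.1 hG
    obtain ⟨l, rfl⟩ := mk_eq_mk.1 hF.symm
    have h1 := GridFlip.top_le h 0
    have h2 := GridFlip.top_le h' 0
    have h3 := GridFlip.le_bot h 0
    have h4 := GridFlip.le_bot h' 0
    simp only [GridFlip.shift, GridPath.shift] at h1 h2 h3 h4
    have e : l * (b : ℤ) = -(k * b) := by omega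
    have h5 : G' ≤ F.shift (-(k * b)) := e ▸ h'
    have h6 := GridFlip.shift_le_shift h5 (k * b)
    rw [GridFlip.shift_shift, neg_add_cancel, GridFlip.shift_zero] at h6
    rw [GridFlip.le_antisymm' h h6]

end BandFlip

/-- The `b`-band torus front complex: its cells are the flips of `b`-band `(m, n)`-torus fronts
all of whose members have all horizontal legs of length at least `g`. -/
def torusFrontComplex (b m n g : ℕ) : Set (BandFlip b m n) :=
  {c | ∃ F : GridFlip m n, BandFlip.mk b F = c ∧ ∀ p, F.Member p → p.LegsAtLeast g}

/-- The subcomplex of all thin `b`-band flips: the flips of width, that is, of maximal width of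
a member, at most `√2`. -/
def thinTorusFrontComplex (b m n g : ℕ) : Set (BandFlip b m n) :=
  {c | c ∈ torusFrontComplex b m n g ∧
    ∃ F : GridFlip m n, BandFlip.mk b F = c ∧ ∀ p, F.Member p → p.Thin}

/-! ## Complexes of graph homomorphisms -/

/-- The cells of the prodsimplicial complex `Hom(T, G)`: the products of simplices
`∏ x, σ x`, with `σ x` a nonempty set of vertices of `G`, such that `(σ x, σ y)` is a complete
bipartite subgraph of `G` for every edge `(x, y)` of `T`. -/
@[ext] structure HomCell {V W : Type*} (T : SimpleGraph V) (G : SimpleGraph W) where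
  toFun : V → Finset W
  nonempty : ∀ x, (toFun x).Nonempty
  adj : ∀ x y, T.Adj x y → ∀ a ∈ toFun x, ∀ b ∈ toFun y, G.Adj a b

namespace HomCell

variable {V W : Type*} {T : SimpleGraph V} {G : SimpleGraph W}

/-- The face relation. -/
instance : PartialOrder (HomCell T G) :=
  PartialOrder.lift HomCell.toFun fun _ _ h => HomCell.ext h

/-- The graph homomorphism `f` is a vertex of the cell `σ`. -/
def HasVertex (σ : HomCell T G) (f : T →g G) : Prop := ∀ x, f x ∈ σ.toFun x

/-- The cell is a cube, that is, a product of points and edges, of dimension `d`. -/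
def IsCube [Fintype V] (σ : HomCell T G) (d : ℕ) : Prop :=
  (∀ x, (σ.toFun x).card ≤ 2) ∧ ∑ x, ((σ.toFun x).card - 1) = d

/-- The graph homomorphism `f`, as a zero-dimensional cell. -/
def vertex (f : T →g G) : HomCell T G where
  toFun x := {f x}
  nonempty x := Finset.singleton_nonempty _
  adj x y h a ha b hb := by
    rw [Finset.mem_singleton] at ha hb
    subst ha hb
    exact f.map_adj h

/-- `f` and `g` are opposite vertices of the cube `σ`: in each factor of the product, which is
a point or an edge, their coordinates are all the vertices of that factor. -/
def Opposite [DecidableEq W] (σ : HomCell T G) (f g : T →g G) : Prop :=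
  ∀ x, σ.toFun x = {f x, g x}

/-- The set of cells `Y` is the disjoint union of `s` circles formed by altogether `N` cubes of
dimension `d` that are linked at opposite vertices. The `a`-th circle consists of `ℓ a`
cubes `c a i`, with `i` modulo `ℓ a`; the opposite vertices `v a i` and `v a (i + 1)` of `c a i` are
the ones in which it meets `c a (i - 1)` and `c a (i + 1)`, and there are no other
intersections. -/
def IsGarland [Fintype V] [DecidableEq W] (Y : Set (HomCell T G)) (s N d : ℕ) : Prop :=
  ∃ (ℓ : Fin s → ℕ) (c : ∀ a, ZMod (ℓ a) → HomCell T G) (v : ∀ a, ZMod (ℓ a) → (T →g G)),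
    (∀ a, 2 ≤ ℓ a) ∧ ∑ a, ℓ a = N ∧
    Y = {σ | ∃ a i, σ ≤ c a i} ∧
    (∀ a i, (c a i).IsCube d) ∧
    (∀ a, Function.Injective (c a)) ∧
    (∀ a i, (c a i).Opposite (v a i) (v a (i + 1))) ∧
    (∀ a i j, i ≠ j → ∀ σ, σ ≤ c a i → σ ≤ c a j →
      (j = i + 1 ∧ σ = vertex (v a j)) ∨ (i = j + 1 ∧ σ = vertex (v a i))) ∧
    (∀ a a', a ≠ a' → ∀ i j σ, σ ≤ c a i → ¬ σ ≤ c a' j)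

end HomCell

/-! ## Maps between cycles -/

section Cycles

open SimpleGraph

/-- `z` is a lift of the map `f` between cycles to a map between the universal covers. -/
def IsCycleLift {m n : ℕ} (f : cycleGraph m →g cycleGraph n) (z : ℤ → ℤ) : Prop :=
  (∀ t, z (t + 1) = z t + 1 ∨ z (t + 1) = z t - 1) ∧
    ∀ (t : ℤ) (i : Fin m), t ≡ (i : ℕ) [ZMOD m] → z t ≡ (f i : ℕ) [ZMOD n]

/-- The map `f` from the `m`-cycle to the `n`-cycle has winding number `w`. -/
def HasWindingNumber {m n : ℕ} (f : cycleGraph m →g cycleGraph n) (w : ℤ) : Prop :=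
  ∃ z, IsCycleLift f z ∧ ∀ t, z (t + m) = z t + n * w

/-- The subcomplex of `Hom(C_m, C_n)` induced by the vertices with winding number `w`. -/
def windingComplex (m n : ℕ) (w : ℤ) : Set (HomCell (cycleGraph m) (cycleGraph n)) :=
  {σ | ∀ f, σ.HasVertex f → HasWindingNumber f w}

/-- The grid path `p` encodes the map `f` between cycles: as one follows `p`, northbound edges
correspond to `f` moving one step forward, eastbound edges to `f` moving one step backward. -/
def GridPath.Encodes {k l m n : ℕ} (p : GridPath k l) (f : cycleGraph m →g cycleGraph n) :
    Prop :=
  ∃ q : ℤ, IsCycleLift f fun t => q + 2 * p.y t - t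

/-- The thin part of the subcomplex induced by the vertices with winding number `w`, where
`r = (m - n * w) / 2` is the number of backward steps of each such vertex: it consists of the cells
all of whose vertices are encoded by thin paths. -/
def thinWindingComplex (m n : ℕ) (w : ℤ) (r : ℕ) :
    Set (HomCell (cycleGraph m) (cycleGraph n)) :=
  {σ | σ ∈ windingComplex m n w ∧
    ∀ f, σ.HasVertex f → ∃ p : GridPath r (m - r), p.Encodes f ∧ p.Thin}

end Cycles

/-!
The proof works with the integer height `(m + n) y - n t` of the vertex of a grid path on the line
`x + y = t`. Its residue modulo `m + n` depends only on `t`, the highest vertices of a path are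
northwestern sharp corners, and flipping such a corner lowers its height by `m + n`. A path is thin
if and only if its heights differ by at most `m + n`, and a flip has a member that is not thin if
and only if the highest vertex of its top path is more than `m + n` above the lowest vertex
of its bottom path.

*Collapse.* The flips that are not thin are matched by toggling a highest corner of the top path,
that is, by adding it to the flipped corners or removing it from them (`GridFlip.toggle`). This
preserves the top path and the lowest height of the bottom path. It also respects the condition on
the legs, because the leg that starts at a highest vertex has at least the average length
`(m + n) / n`, and if `g` reaches this average then all members are thin
(`GridFlip.thin_of_legsAtLeast`, `GridFlip.legsAtLeast_toggle`). The matching is acyclic: going to a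
larger cell raises the top path relative to the lowest height of the bottom path, or keeps both and
lowers the rest of the bottom path (`GridFlip.rank_lt_rank`). Hence the flips can be collapsed in
the order of decreasing rank (`collapsesTo_of_involution`).

*Coverings.* The collapse is carried out for every complex that is covered by the flips of grid paths,
up to translation by multiples of `(-b, b)` (`IsBandCover`). This comprises the torus front complexes
and the complexes of homomorphisms with a fixed winding number. Since `n ≠ 4`, two vertices of the
`n`-cycle have at most one common neighbour, so that a cell allows at most two choices at each
vertex, and only one at the neighbours of a vertex with two choices. Lifting to the universal
cover of the `n`-cycle turns the cell into a flip (`WindingData.exists_eq_cell`). Translation by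
`(-1, 1)` changes the starting point of the lift by `2`, so there is one component with `b = n`
if `n` is odd, and there are two components with `b = n / 2` if `n` is even.

*Garland.* With `d = gcd m n`, all heights are multiples of `d`. The thin flips are the faces of
the flips `GridFlip.cube` with heights from `c` to `c + m + n`, for the multiples `c` of `d`. In
such a flip, a height is determined by its residue, except for the `d` vertices whose height
is congruent to `c`; these are the flipped corners. The flips for `c` and `c + d` share the single
path with heights from `c + d` to `c + m + n`, and flips that are further apart are disjoint
(`GridFlip.eq_single_of_le_cube_of_le_cube`). Translation by `(-b, b)` adds `(m + n) b` to `c`, which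
leaves a circle of `(m + n) b / d` cubes.
-/

/-! ### Collapsing along a matching -/

/-- The cells of `K` outside `L` can be collapsed in the order of decreasing rank `f` if they are
matched in pairs of equal rank, and all other cells above the lower cell of a pair have a higher
rank. -/
theorem collapsesTo_of_involution {C : Type*} [PartialOrder C] {R : Type*} [LinearOrder R]
    (K L : Set C) (hLK : L ⊆ K) (hfin : (K \ L).Finite) (μ : C → C) (f : C → R)
    (hμ : ∀ c ∈ K \ L, μ c ∈ K \ L) (hinv : ∀ c ∈ K \ L, μ (μ c) = c)
    (hlt : ∀ c ∈ K \ L, c < μ c ∨ μ c < c) (hf : ∀ c ∈ K \ L, f (μ c) = f c)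
    (hup : ∀ c ∈ K \ L, c < μ c → ∀ ρ ∈ K, c < ρ → ρ ≠ μ c → ρ ∉ L ∧ f c < f ρ) :
    CollapsesTo K L := by
  obtain ⟨k, hk⟩ : ∃ k, (K \ L).ncard = k := ⟨_, rfl⟩
  induction k using Nat.strong_induction_on generalizing K with
  | _ k ih =>
  rcases (K \ L).eq_empty_or_nonempty with he | hne
  · rw [Set.sdiff_eq_empty] at he
    rw [hLK.antisymm he]
    exact Relation.ReflTransGen.refl
  obtain ⟨c₀, hc₀, hmax₀⟩ := Set.exists_max_image _ f hfin hne
  -- the lower cell of the pair of maximal rank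
  obtain ⟨c, hc, hmax, hclt⟩ : ∃ c ∈ K \ L, (∀ a ∈ K \ L, f a ≤ f c) ∧ c < μ c := by
    rcases hlt c₀ hc₀ with h | h
    · exact ⟨c₀, hc₀, hmax₀, h⟩
    · exact ⟨μ c₀, hμ _ hc₀, by rwa [hf _ hc₀], by rwa [hinv _ hc₀]⟩
  have hm := hμ c hc
  have hsub : (K \ {c, μ c}) \ L ⊆ K \ L := fun x hx => ⟨hx.1.1, hx.2⟩
  have hcol : ElementaryCollapse K (K \ {c, μ c}) := by
    refine ⟨c, hc.1, μ c, hm.1, hclt, fun ρ hρ hcρ => ?_, rfl⟩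
    by_contra hne
    obtain ⟨h1, h2⟩ := hup c hc hclt ρ hρ hcρ hne
    exact absurd (hmax ρ ⟨hρ, h1⟩) (not_le.2 h2)
  refine Relation.ReflTransGen.head hcol
    (ih ((K \ {c, μ c}) \ L).ncard ?_ _ ?_ (hfin.subset hsub) ?_ ?_ ?_ ?_ ?_ rfl)
  · rw [← hk]
    refine Set.ncard_lt_ncard ⟨hsub, fun h => ?_⟩ hfin
    exact (h hc).1.2 (Or.inl rfl)
  · intro x hx
    refine ⟨hLK hx, ?_⟩
    rintro (rfl | rfl)
    · exact hc.2 hx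
    · exact hm.2 hx
  · intro x hx
    have h1 := hμ x (hsub hx)
    refine ⟨⟨h1.1, ?_⟩, h1.2⟩
    rintro (h | h)
    · exact hx.1.2 (Or.inr (by rw [← h, hinv x (hsub hx)]; rfl))
    · exact hx.1.2 (Or.inl (by rw [← hinv x (hsub hx), h, hinv c hc]))
  · exact fun x hx => hinv x (hsub hx)
  · exact fun x hx => hlt x (hsub hx)
  · exact fun x hx => hf x (hsub hx)
  · exact fun x hx hxm ρ hρ => hup x (hsub hx) hxm ρ hρ.1

/-! ### Heights along a grid path -/

namespace GridPath

variable {m n : ℕ}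

theorem y_add_mul (p : GridPath m n) (t j : ℤ) : p.y (t + (m + n) * j) = p.y t + n * j := by
  induction j using Int.induction_on with
  | zero => simp
  | succ i ih =>
    have := p.periodic (t + (m + n) * i)
    rw [show t + ((m : ℤ) + n) * (i + 1) = t + (m + n) * i + (m + n) by ring, this, ih]
    ring
  | pred i ih =>
    have := p.periodic (t + (m + n) * (-i - 1))
    rw [show t + ((m : ℤ) + n) * (-i - 1) + (m + n) = t + (m + n) * (-i) by ring, ih] at this
    linarith

theorem le_step (p : GridPath m n) (t : ℤ) : p.y t ≤ p.y (t + 1) := by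
  rcases p.step t with h | h <;> omega

theorem step_le (p : GridPath m n) (t : ℤ) : p.y (t + 1) ≤ p.y t + 1 := by
  rcases p.step t with h | h <;> omega

theorem y_monotone (p : GridPath m n) : Monotone p.y :=
  monotone_int_of_le_succ p.le_step

theorem y_add_le (p : GridPath m n) (t : ℤ) (k : ℕ) : p.y (t + k) ≤ p.y t + k := by
  induction k with
  | zero => simp
  | succ k ih =>
    have := p.step_le (t + k)
    push_cast
    rw [← add_assoc]
    omega

/-- The height of the vertex of the path on the line `x + y = t` above the line through `(0, 0)`
and `(m, n)`, as an integer: it is `m + n` times `p.offset t`. Its residue modulo `m + n` depends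
only on `t`, and the elementary flips change it by `m + n`. -/
def height (p : GridPath m n) (t : ℤ) : ℤ := (m + n) * p.y t - n * t

theorem height_shift (p : GridPath m n) (k t : ℤ) :
    (p.shift k).height t = p.height t + (m + n) * k := by
  simp only [height, shift]; ring

theorem height_periodic (p : GridPath m n) (t j : ℤ) :
    p.height (t + (m + n) * j) = p.height t := by
  simp only [height, y_add_mul]; ring

theorem offset_eq (p : GridPath m n) (t : ℤ) :
    p.offset t = (p.height t : ℝ) / ((m : ℝ) + n) := by
  simp only [offset, height]; push_cast; ring

theorem legsAtLeast_shift {p : GridPath m n} {g : ℕ} (h : p.LegsAtLeast g) (k : ℤ) :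
    (p.shift k).LegsAtLeast g := by
  intro t ht j hj hjg
  simp only [shift] at ht ⊢
  rw [h t (by omega) j hj hjg]

variable [NeZero m]

theorem size_pos : (0 : ℤ) < m + n := by
  have := NeZero.pos m
  omega

theorem exists_height_le (p : GridPath m n) : ∃ t : ℕ, ∀ s, p.height s ≤ p.height t := by
  obtain ⟨t, ht, hmax⟩ := Finset.exists_max_image (Finset.Ico (0 : ℤ) (m + n)) p.height
    ⟨0, Finset.mem_Ico.2 ⟨le_rfl, size_pos⟩⟩
  obtain ⟨k, rfl⟩ := Int.eq_ofNat_of_zero_le (Finset.mem_Ico.1 ht).1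
  refine ⟨k, fun s => ?_⟩
  have h := hmax (s % (m + n)) (Finset.mem_Ico.2
    ⟨Int.emod_nonneg _ size_pos.ne', Int.emod_lt_of_pos _ size_pos⟩)
  rwa [← p.height_periodic _ (s / (m + n)), Int.emod_add_mul_ediv] at h

theorem exists_le_height (p : GridPath m n) : ∃ t : ℕ, ∀ s, p.height t ≤ p.height s := by
  obtain ⟨t, ht, hmin⟩ := Finset.exists_min_image (Finset.Ico (0 : ℤ) (m + n)) p.height
    ⟨0, Finset.mem_Ico.2 ⟨le_rfl, size_pos⟩⟩
  obtain ⟨k, rfl⟩ := Int.eq_ofNat_of_zero_le (Finset.mem_Ico.1 ht).1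
  refine ⟨k, fun s => ?_⟩
  have h := hmin (s % (m + n)) (Finset.mem_Ico.2
    ⟨Int.emod_nonneg _ size_pos.ne', Int.emod_lt_of_pos _ size_pos⟩)
  rwa [← p.height_periodic (s % (m + n)) (s / (m + n)), Int.emod_add_mul_ediv] at h

theorem thin_iff (p : GridPath m n) :
    p.Thin ↔ ∀ s t, p.height s - p.height t ≤ m + n := by
  have hN : (0 : ℝ) < (m : ℝ) + n := by exact_mod_cast size_pos (m := m) (n := n)
  have key : p.Thin ↔ (⨆ t, p.offset t) - (⨅ t, p.offset t) ≤ 1 := by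
    rw [Thin, width, mul_le_iff_le_one_right (by positivity)]
  obtain ⟨a, ha⟩ := p.exists_height_le
  obtain ⟨b, hb⟩ := p.exists_le_height
  have hle : ∀ s, p.offset s ≤ p.offset a := fun s => by
    rw [offset_eq, offset_eq]
    have : (p.height s : ℝ) ≤ p.height a := by exact_mod_cast ha s
    gcongr
  have hge : ∀ s, p.offset b ≤ p.offset s := fun s => by
    rw [offset_eq, offset_eq]
    have : (p.height b : ℝ) ≤ p.height s := by exact_mod_cast hb s
    gcongr
  have hsup : (⨆ t, p.offset t) = p.offset a :=
    le_antisymm (ciSup_le hle) (le_ciSup ⟨p.offset a, by rintro _ ⟨s, rfl⟩; exact hle s⟩ (a : ℤ))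
  have hinf : (⨅ t, p.offset t) = p.offset b :=
    le_antisymm (ciInf_le ⟨p.offset b, by rintro _ ⟨s, rfl⟩; exact hge s⟩ (b : ℤ)) (le_ciInf hge)
  rw [key, hsup, hinf, offset_eq, offset_eq, ← sub_div, div_le_one hN]
  constructor
  · intro h s t
    have h' : p.height a - p.height b ≤ m + n := by exact_mod_cast h
    linarith [ha s, hb t]
  · intro h
    exact_mod_cast h a b

theorem thin_shift (p : GridPath m n) (k : ℤ) : (p.shift k).Thin ↔ p.Thin := by
  simp only [thin_iff, height_shift, add_sub_add_right_eq_sub]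

/-- The position of a highest vertex of the path: the least one among the natural numbers. The
choice is invariant under translation of the path. -/
noncomputable def peak (p : GridPath m n) : ℕ := by
  classical exact Nat.find p.exists_height_le

theorem height_le_peak (p : GridPath m n) (s : ℤ) : p.height s ≤ p.height p.peak := by
  classical exact Nat.find_spec p.exists_height_le s

theorem peak_shift (p : GridPath m n) (k : ℤ) : (p.shift k).peak = p.peak := by
  classical
  have h : ∀ t : ℕ, (∀ s, (p.shift k).height s ≤ (p.shift k).height t) ↔
      ∀ s, p.height s ≤ p.height t := fun t => by
    simp only [height_shift, add_le_add_iff_right]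
  exact Nat.find_congr' (h _)

/-- The height of the lowest vertices of the path. -/
noncomputable def floor (p : GridPath m n) : ℤ := by
  classical exact p.height (Nat.find p.exists_le_height : ℕ)

theorem floor_le (p : GridPath m n) (s : ℤ) : p.floor ≤ p.height s := by
  classical exact Nat.find_spec p.exists_le_height s

theorem exists_height_eq_floor (p : GridPath m n) : ∃ t, p.height t = p.floor := ⟨_, rfl⟩

theorem floor_shift (p : GridPath m n) (k : ℤ) :
    (p.shift k).floor = p.floor + (m + n) * k := by
  obtain ⟨s, hs⟩ := p.exists_height_eq_floor
  obtain ⟨t, ht⟩ := (p.shift k).exists_height_eq_floor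
  have h1 := (p.shift k).floor_le s
  have h2 := p.floor_le t
  rw [height_shift] at h1 ht
  linarith

variable [NeZero n]

/-- A highest vertex of a path is a northwestern sharp corner. -/
theorem corner_of_forall_height_le {p : GridPath m n} {t : ℤ}
    (h : ∀ s, p.height s ≤ p.height t) : p.y t = p.y (t - 1) + 1 ∧ p.y (t + 1) = p.y t := by
  have hm := NeZero.pos m
  have hn := NeZero.pos n
  have h1 := h (t - 1)
  have h2 := h (t + 1)
  have s1 := p.step (t - 1)
  have s2 := p.step t
  rw [sub_add_cancel] at s1
  simp only [height] at h1 h2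
  constructor
  · rcases s1 with e | e
    · rw [← e] at h1
      linarith
    · exact e
  · rcases s2 with e | e
    · exact e
    · rw [e] at h2
      linarith

end GridPath

/-! ### Flips given by sets of corners -/

namespace GridFlip

variable {m n : ℕ}

/-- The flip of the path `p` at the northwestern sharp corners in the positions belonging to `S`. -/
noncomputable def ofCorners (p : GridPath m n) (S : Set ℤ) (hS : ∀ t : ℤ, t + (m + n) ∈ S ↔ t ∈ S)
    (hp : ∀ t ∈ S, p.y t = p.y (t - 1) + 1 ∧ p.y (t + 1) = p.y t) : GridFlip m n := by
  classical exact
  { top := p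
    bot :=
      { y := fun t => if t ∈ S then p.y t - 1 else p.y t
        step := fun t => by
          have h0 := p.step t
          split_ifs with h1 h2 h2
          · have := hp _ h2; have := hp _ h1
            rw [add_sub_cancel_right] at this; omega
          · have := hp _ h1; rw [add_sub_cancel_right] at this; omega
          · have := hp _ h2; omega
          · exact h0
        periodic := fun t => by
          rw [p.periodic]
          by_cases h : t ∈ S
          · rw [if_pos ((hS t).2 h), if_pos h]; ring
          · rw [if_neg (mt (hS t).1 h), if_neg h] }
    elementary := fun t h => by
      dsimp only at h ⊢
      by_cases ht : t ∈ S
      · rw [if_pos ht]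
        exact ⟨rfl, hp t ht⟩
      · rw [if_neg ht] at h
        exact absurd rfl h
    apart := fun t h => by
      dsimp only at h ⊢
      by_cases ht : t ∈ S
      · have h1 := hp t ht
        refine if_neg fun h2 => ?_
        have h3 := hp _ h2
        rw [add_sub_cancel_right] at h3
        omega
      · rw [if_neg ht] at h
        exact absurd rfl h }

@[simp] theorem ofCorners_top (p : GridPath m n) (S : Set ℤ) (hS hp) :
    (ofCorners p S hS hp).top = p := rfl

theorem ofCorners_bot_of_mem {p : GridPath m n} {S : Set ℤ} {hS hp} {t : ℤ} (ht : t ∈ S) :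
    (ofCorners p S hS hp).bot.y t = p.y t - 1 := if_pos ht

theorem ofCorners_bot_of_notMem {p : GridPath m n} {S : Set ℤ} {hS hp} {t : ℤ} (ht : t ∉ S) :
    (ofCorners p S hS hp).bot.y t = p.y t := if_neg ht

theorem le_iff {F G : GridFlip m n} :
    F ≤ G ↔ (∀ t, F.top.y t ≤ G.top.y t) ∧ ∀ t, G.bot.y t ≤ F.bot.y t := by
  refine ⟨fun h => ⟨top_le h, le_bot h⟩, fun ⟨h1, h2⟩ p hp t => ?_⟩
  have e1 := h1 t
  have e2 := h2 t
  have e3 := F.bot_le t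
  have e4 := hp t
  by_cases h : G.bot.y t = G.top.y t
  · omega
  · have := (G.elementary t h).1
    omega

theorem bot_eq (F : GridFlip m n) (t : ℤ) :
    F.bot.y t = F.top.y t ∨ F.bot.y t = F.top.y t - 1 := by
  by_cases h : F.bot.y t = F.top.y t
  · exact Or.inl h
  · exact Or.inr (F.elementary t h).1

theorem Member.le_top {F : GridFlip m n} {p : GridPath m n} (h : F.Member p) (t : ℤ) :
    p.y t ≤ F.top.y t := by
  have := h t; have := F.bot_le t; omega

theorem Member.bot_le {F : GridFlip m n} {p : GridPath m n} (h : F.Member p) (t : ℤ) :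
    F.bot.y t ≤ p.y t := by
  have := h t; have := F.bot_le t; omega

/-- Positions of the vertices of a flip chosen on consecutive lines `x + y = t` can always be
joined by an edge. -/
theorem step_of_choice (F : GridFlip m n) {t u v : ℤ} (hu : u = F.top.y t ∨ u = F.bot.y t)
    (hv : v = F.top.y (t + 1) ∨ v = F.bot.y (t + 1)) : v = u ∨ v = u + 1 := by
  have h0 := F.top.step t
  by_cases h : F.bot.y t = F.top.y t
  · by_cases h' : F.bot.y (t + 1) = F.top.y (t + 1)
    · omega
    · have := F.elementary _ h'
      rw [add_sub_cancel_right] at this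
      omega
  · have h1 := F.elementary _ h
    have h2 := F.apart _ h
    omega

/-- The member of a flip in which exactly the corners in the positions belonging to `S` are in
the northwestern position. -/
noncomputable def select (F : GridFlip m n) (S : Set ℤ) (hS : ∀ t : ℤ, t + (m + n) ∈ S ↔ t ∈ S) :
    GridPath m n := by
  classical exact
  { y := fun t => if t ∈ S then F.top.y t else F.bot.y t
    step := fun t => by
      refine F.step_of_choice (t := t) ?_ ?_
      · by_cases h : t ∈ S
        · exact Or.inl (if_pos h)
        · exact Or.inr (if_neg h)
      · by_cases h : t + 1 ∈ S
        · exact Or.inl (if_pos h)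
        · exact Or.inr (if_neg h)
    periodic := fun t => by
      rw [F.top.periodic, F.bot.periodic]
      by_cases h : t ∈ S
      · rw [if_pos ((hS t).2 h), if_pos h]
      · rw [if_neg (mt (hS t).1 h), if_neg h] }

theorem select_of_mem {F : GridFlip m n} {S : Set ℤ} {hS} {t : ℤ} (ht : t ∈ S) :
    (F.select S hS).y t = F.top.y t := if_pos ht

theorem select_of_notMem {F : GridFlip m n} {S : Set ℤ} {hS} {t : ℤ} (ht : t ∉ S) :
    (F.select S hS).y t = F.bot.y t := if_neg ht

theorem member_select (F : GridFlip m n) (S : Set ℤ) (hS) : F.Member (F.select S hS) := by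
  intro t
  by_cases h : t ∈ S
  · exact Or.inl (select_of_mem h)
  · exact Or.inr (select_of_notMem h)

theorem member_shift {F : GridFlip m n} {k : ℤ} {p : GridPath m n} :
    (F.shift k).Member p ↔ F.Member (p.shift (-k)) := by
  refine forall_congr' fun t => ?_
  simp only [shift, GridPath.shift]
  omega

theorem dvd_periodic (a t : ℤ) :
    ((m : ℤ) + n) ∣ t + (m + n) - a ↔ ((m : ℤ) + n) ∣ t - a := by
  rw [add_sub_right_comm, dvd_add_left (dvd_refl _)]

/-- The top and the bottom of a flip are simultaneously the extremes of one member, except at a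
vertex where the difference of heights is at most `m + n` anyway. -/
theorem forall_thin_iff [NeZero m] [NeZero n] (F : GridFlip m n) :
    (∀ p, F.Member p → p.Thin) ↔ ∀ s t, F.top.height s - F.bot.height t ≤ m + n := by
  have hN := GridPath.size_pos (m := m) (n := n)
  constructor
  · intro h s t
    by_cases hst : ((m : ℤ) + n) ∣ s - t
    · obtain ⟨j, hj⟩ := hst
      obtain rfl : s = t + (m + n) * j := by linarith
      rw [GridPath.height_periodic]
      simp only [GridPath.height]
      rcases F.bot_eq t with e | e <;> rw [e] <;> linarith
    · have h1 := (GridPath.thin_iff _).1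
        (h (F.select {u | ((m : ℤ) + n) ∣ u - s} (dvd_periodic s)) (F.member_select _ _)) s t
      rw [GridPath.height, GridPath.height, select_of_mem (by simp),
        select_of_notMem] at h1
      · exact h1
      · intro h'
        exact hst ((dvd_sub_comm).1 h')
  · intro h p hp
    rw [GridPath.thin_iff]
    intro s t
    refine le_trans ?_ (h s t)
    simp only [GridPath.height]
    have h1 := mul_le_mul_of_nonneg_left (hp.le_top s) hN.le
    have h2 := mul_le_mul_of_nonneg_left (hp.bot_le t) hN.le
    linarith

end GridFlip

namespace GridPath

variable {m n : ℕ}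

/-! ### Horizontal legs -/

theorem LegsAtLeast.y_add_le {g : ℕ} {p : GridPath m n} (h : p.LegsAtLeast g) {k : ℕ}
    (hk : k ≤ g) (t : ℤ) : p.y (t + k) ≤ p.y t + 1 := by
  induction k generalizing t with
  | zero => simp
  | succ k ih =>
    push_cast
    rcases p.step t with e | e
    · have := ih (by omega) (t + 1)
      rw [add_assoc, add_comm 1 (k : ℤ)] at this
      omega
    · have := h t e (k + 1) (by omega) hk
      push_cast at this
      omega

/-- If the minimal length `g` of the legs reaches the average length `(m + n) / n`, then all legs
have length exactly `g`. -/
theorem LegsAtLeast.y_add_eq {g : ℕ} {p : GridPath m n} (h : p.LegsAtLeast g)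
    (hg : m + n ≤ n * g) (hn : 0 < m + n) (t : ℤ) : p.y (t + g) = p.y t + 1 := by
  refine le_antisymm (h.y_add_le le_rfl t) ?_
  have hj : ∀ (j : ℕ) (s : ℤ), p.y (s + g * j) ≤ p.y s + j := by
    intro j
    induction j with
    | zero => simp
    | succ j ih =>
      intro s
      have h1 := ih s
      have h2 := h.y_add_le le_rfl (s + g * j)
      push_cast
      rw [mul_add, mul_one, ← add_assoc]
      omega
  by_contra hlt
  have h1 := hj (m + n - 1) (t + g)
  have h2 := p.y_add_mul t g
  rw [show t + (g : ℤ) + g * ((m + n - 1 : ℕ) : ℤ) = t + (m + n) * g by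
    rw [Nat.cast_sub hn]; push_cast; ring, h2, Nat.cast_sub hn] at h1
  have h3 : (m : ℤ) + n ≤ n * g := by exact_mod_cast hg
  push_cast at h1
  omega

end GridPath

namespace GridFlip

variable {m n : ℕ} [NeZero m]

/-- The chosen highest vertex of the top path is a flipped corner. -/
def PeakFlipped (F : GridFlip m n) : Prop := F.bot.y F.top.peak ≠ F.top.y F.top.peak

theorem bot_eq_top_of_dvd {F : GridFlip m n} (h : ¬ F.PeakFlipped) {t : ℤ}
    (ht : ((m : ℤ) + n) ∣ t - F.top.peak) : F.bot.y t = F.top.y t := by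
  obtain ⟨j, hj⟩ := ht
  obtain rfl : t = F.top.peak + (m + n) * j := by linarith
  rw [GridPath.y_add_mul, GridPath.y_add_mul, not_not.1 h]

variable [NeZero n]

/-- If the legs have at least the average length, then they all have this length, and the only
corners are the highest vertices, whose flips lead to thin paths. -/
theorem thin_of_legsAtLeast {F : GridFlip m n} {g : ℕ}
    (hF : ∀ p, F.Member p → p.LegsAtLeast g) (hg : m + n ≤ n * g) (p : GridPath m n)
    (hp : F.Member p) : p.Thin := by
  have hm := NeZero.pos m
  have hn := NeZero.pos n
  have hN : (0 : ℤ) < m + n := GridPath.size_pos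
  have htop : ∀ t, F.top.y (t + g) = F.top.y t + 1 :=
    (hF _ F.member_top).y_add_eq hg (by omega)
  have hbot : ∀ t, F.bot.y (t + g) = F.bot.y t + 1 :=
    (hF _ F.member_bot).y_add_eq hg (by omega)
  have hgpos : (0 : ℤ) < g := by
    rcases Nat.eq_zero_or_pos g with rfl | h
    · have := htop 0
      simp at this
    · exact_mod_cast h
  have hng : (n : ℤ) * g = m + n := by
    have h1 : ∀ j : ℕ, F.top.y (0 + g * j) = F.top.y 0 + j := fun j => by
      induction j with
      | zero => simp
      | succ j ih =>
        rw [show (0 : ℤ) + g * (j + 1 : ℕ) = 0 + g * j + g by push_cast; ring, htop, ih]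
        push_cast; ring
    have h2 := h1 (m + n)
    have h3 := F.top.y_add_mul 0 g
    rw [show (0 : ℤ) + g * (m + n : ℕ) = 0 + (m + n) * g by push_cast; ring, h3] at h2
    push_cast at h2
    linarith
  refine (forall_thin_iff F).2 (fun s t => ?_) p hp
  have hs := F.top.height_le_peak s
  set k := F.top.peak
  have hk := GridPath.corner_of_forall_height_le F.top.height_le_peak
  -- reduce to a position `t` in the leg that starts at a highest vertex
  obtain ⟨a, ha⟩ : ∃ a : ℤ, a = t - (t - k) / g * g := ⟨_, rfl⟩
  have h1 : ∀ j : ℤ, F.bot.height (t + g * j) = F.bot.height t := fun j => by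
    induction j using Int.induction_on with
    | zero => simp
    | succ i ih =>
      rw [← ih]
      have := hbot (t + g * i)
      simp only [GridPath.height]
      rw [show t + (g : ℤ) * (i + 1) = t + g * i + g by ring, this]
      linear_combination -hng
    | pred i ih =>
      rw [← ih]
      have := hbot (t + g * (-i - 1))
      rw [show t + (g : ℤ) * (-i - 1) + g = t + g * (-i) by ring] at this
      simp only [GridPath.height]
      rw [this]
      linear_combination hng
  have h2 : F.bot.height t = F.bot.height a := by
    rw [ha, ← h1 (-((t - k) / g))]; congr 1; ring
  have h3 := Int.emod_add_mul_ediv (t - k) g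
  have h4 := Int.emod_nonneg (t - k) hgpos.ne'
  have h5 := Int.emod_lt_of_pos (t - k) hgpos
  have h6 : a = k + (t - k) % g := by rw [ha]; linear_combination -h3
  rw [h2]
  suffices F.top.height k - F.bot.height a ≤ m + n by linarith
  have hb : F.bot.y k = F.top.y k ∨ F.bot.y k = F.top.y k - 1 := F.bot_eq k
  rcases h4.eq_or_lt with h0 | h0
  · rw [← h0, add_zero] at h6
    rw [h6]
    simp only [GridPath.height]
    rcases hb with e | e <;> rw [e] <;> linarith
  · have e1 : F.top.y k ≤ F.bot.y (k + 1) := by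
      by_cases e : F.bot.y k = F.top.y k
      · rw [← e]; exact F.bot.le_step k
      · rw [F.apart _ e, hk.2]
    have e2 := F.bot.y_monotone (show (k : ℤ) + 1 ≤ a by omega)
    simp only [GridPath.height]
    have e3 := mul_le_mul_of_nonneg_left (e1.trans e2) hN.le
    have e4 : (n : ℤ) * (a - k) ≤ n * g := mul_le_mul_of_nonneg_left (by omega) (by positivity)
    linarith

/-! ### The matching of the flips that are not thin -/

theorem top_corner_of_dvd_sub_peak (F : GridFlip m n) {t : ℤ}
    (ht : ((m : ℤ) + n) ∣ t - F.top.peak) :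
    F.top.y t = F.top.y (t - 1) + 1 ∧ F.top.y (t + 1) = F.top.y t := by
  obtain ⟨j, hj⟩ := ht
  obtain rfl : t = F.top.peak + (m + n) * j := by linarith
  refine GridPath.corner_of_forall_height_le fun s => ?_
  rw [GridPath.height_periodic]
  exact F.top.height_le_peak s

/-- The flip obtained by adding the corner at the chosen highest vertex of the top path to the
flipped corners, or by removing it if it is already flipped; in the latter case it ends up in the
northwestern position, so that the top path does not change. -/
noncomputable def toggle (F : GridFlip m n) : GridFlip m n :=
  ofCorners F.top
    {t | ((m : ℤ) + n) ∣ t - F.top.peak ∧ F.bot.y t = F.top.y t ∨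
      ¬ ((m : ℤ) + n) ∣ t - F.top.peak ∧ F.bot.y t ≠ F.top.y t}
    (fun t => by
      simp only [Set.mem_ofPred_eq, dvd_periodic, F.bot.periodic, F.top.periodic,
        add_left_inj, ne_eq])
    (fun t ht => by
      rcases ht with ⟨h, -⟩ | ⟨-, h⟩
      · exact F.top_corner_of_dvd_sub_peak h
      · exact (F.elementary t h).2)

@[simp] theorem toggle_top (F : GridFlip m n) : F.toggle.top = F.top := rfl

theorem toggle_bot_of_dvd (F : GridFlip m n) {t : ℤ} (ht : ((m : ℤ) + n) ∣ t - F.top.peak) :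
    F.toggle.bot.y t = 2 * F.top.y t - 1 - F.bot.y t := by
  by_cases h : F.bot.y t = F.top.y t
  · rw [toggle, ofCorners_bot_of_mem (Or.inl ⟨ht, h⟩)]; omega
  · rw [toggle, ofCorners_bot_of_notMem]
    · have := F.bot_eq t; omega
    · rintro (h' | h')
      · exact h h'.2
      · exact h'.1 ht

theorem toggle_bot_of_not_dvd (F : GridFlip m n) {t : ℤ}
    (ht : ¬ ((m : ℤ) + n) ∣ t - F.top.peak) : F.toggle.bot.y t = F.bot.y t := by
  by_cases h : F.bot.y t = F.top.y t
  · rw [toggle, ofCorners_bot_of_notMem, h]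
    rintro (h' | h')
    · exact ht h'.1
    · exact h'.2 h
  · rw [toggle, ofCorners_bot_of_mem (Or.inr ⟨ht, h⟩)]
    have := F.bot_eq t; omega

theorem toggle_toggle (F : GridFlip m n) : F.toggle.toggle = F := by
  ext t
  · rfl
  · by_cases h : ((m : ℤ) + n) ∣ t - F.top.peak
    · rw [toggle_bot_of_dvd F.toggle h, toggle_bot_of_dvd F h, toggle_top]; ring
    · rw [toggle_bot_of_not_dvd F.toggle h, toggle_bot_of_not_dvd F h]

theorem toggle_shift (F : GridFlip m n) (k : ℤ) : (F.shift k).toggle = F.toggle.shift k := by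
  have hpk : (F.shift k).top.peak = F.top.peak := F.top.peak_shift k
  ext t
  · rfl
  · by_cases h : ((m : ℤ) + n) ∣ t - F.top.peak
    · rw [toggle_bot_of_dvd (F.shift k) (by rwa [hpk])]
      simp only [shift, GridPath.shift]
      rw [toggle_bot_of_dvd F h]; ring
    · rw [toggle_bot_of_not_dvd (F.shift k) (by rwa [hpk])]
      simp only [shift, GridPath.shift]
      rw [toggle_bot_of_not_dvd F h]

theorem peakFlipped_toggle (F : GridFlip m n) : F.toggle.PeakFlipped ↔ ¬ F.PeakFlipped := by
  have h := F.toggle_bot_of_dvd (t := F.top.peak) (by simp)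
  have := F.bot_eq F.top.peak
  simp only [PeakFlipped, toggle_top, h]
  omega

theorem le_toggle {F : GridFlip m n} (h : ¬ F.PeakFlipped) : F ≤ F.toggle := by
  refine le_iff.2 ⟨fun t => le_rfl, fun t => ?_⟩
  by_cases ht : ((m : ℤ) + n) ∣ t - F.top.peak
  · rw [toggle_bot_of_dvd F ht]
    have := bot_eq_top_of_dvd h ht
    omega
  · rw [toggle_bot_of_not_dvd F ht]

theorem toggle_le {F : GridFlip m n} (h : F.PeakFlipped) : F.toggle ≤ F := by
  have := le_toggle (F := F.toggle) (by rw [peakFlipped_toggle]; exact not_not.2 h)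
  rwa [toggle_toggle] at this

/-- The flip has a member that is not thin. -/
def Wide (F : GridFlip m n) : Prop := (m : ℤ) + n < F.top.height F.top.peak - F.bot.floor

theorem not_wide_iff (F : GridFlip m n) : ¬ F.Wide ↔ ∀ p, F.Member p → p.Thin := by
  rw [forall_thin_iff, Wide, not_lt]
  constructor
  · intro h s t
    linarith [F.top.height_le_peak s, F.bot.floor_le t]
  · intro h
    obtain ⟨t, ht⟩ := F.bot.exists_height_eq_floor
    rw [← ht]
    exact h _ _

/-- Flipping a highest vertex of a flip that is not thin does not produce a new lowest vertex. -/
theorem floor_toggle {F : GridFlip m n} (h : F.Wide) : F.toggle.bot.floor = F.bot.floor := by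
  have hN : (0 : ℤ) < m + n := GridPath.size_pos
  have key : ∀ t, ((m : ℤ) + n) ∣ t - F.top.peak → ∀ z, F.top.y t - 1 ≤ z →
      F.bot.floor < (m + n) * z - n * t := by
    rintro t ⟨j, hj⟩ z hz
    obtain rfl : t = F.top.peak + (m + n) * j := by linarith
    have h1 := F.top.height_periodic F.top.peak j
    have h2 := mul_le_mul_of_nonneg_left hz hN.le
    rw [Wide, ← h1, GridPath.height] at h
    linarith
  apply le_antisymm
  · obtain ⟨t, ht⟩ := F.bot.exists_height_eq_floor
    have h1 : ¬ ((m : ℤ) + n) ∣ t - F.top.peak := fun hd => by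
      have := key t hd (F.bot.y t) (by have := F.bot_eq t; omega)
      rw [← ht, GridPath.height] at this
      exact lt_irrefl _ this
    have h2 := F.toggle.bot.floor_le t
    rwa [GridPath.height, toggle_bot_of_not_dvd F h1, ← GridPath.height, ht] at h2
  · obtain ⟨t, ht⟩ := F.toggle.bot.exists_height_eq_floor
    rw [← ht]
    by_cases hd : ((m : ℤ) + n) ∣ t - F.top.peak
    · exact (key t hd _ (by have := F.toggle.bot_eq t; rw [toggle_top] at this; omega)).le
    · rw [GridPath.height, toggle_bot_of_not_dvd F hd]
      exact F.bot.floor_le t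

theorem wide_toggle {F : GridFlip m n} (h : F.Wide) : F.toggle.Wide := by
  rw [Wide, floor_toggle h]
  exact h

/-- In a flip that is not thin, the leg starting at a highest vertex of the top path has more than
`g` vertices, for otherwise `g` would be at least the average length of the legs. Hence the
corner can be flipped. -/
theorem legsAtLeast_toggle {F : GridFlip m n} {g : ℕ} (hw : F.Wide)
    (hF : ∀ p, F.Member p → p.LegsAtLeast g) (q : GridPath m n) (hq : F.toggle.Member q) :
    q.LegsAtLeast g := by
  by_cases hfl : F.PeakFlipped
  · exact hF q (toggle_le hfl q hq)
  intro t ht k hk1 hkg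
  refine le_antisymm ?_ (q.y_monotone (by omega))
  -- the member of `F` that differs from `q` at most at the chosen highest vertex
  let p := F.toggle.select {u | ((m : ℤ) + n) ∣ u - F.top.peak ∨ q.y u = F.top.y u}
    (fun u => by
      simp only [Set.mem_ofPred_eq, dvd_periodic, F.top.periodic, q.periodic, add_left_inj])
  have hpq : ∀ u, ¬ ((m : ℤ) + n) ∣ u - F.top.peak → p.y u = q.y u := by
    intro u hu
    by_cases h : q.y u = F.top.y u
    · rw [select_of_mem (Or.inr h), toggle_top, h]
    · rw [select_of_notMem (by simp [hu, h])]
      exact ((hq u).resolve_left h).symm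
  have hpk : ∀ u, ((m : ℤ) + n) ∣ u - F.top.peak → p.y u = F.top.y u :=
    fun u hu => select_of_mem (Or.inl hu)
  have hle : ∀ u, q.y u ≤ p.y u := by
    intro u
    by_cases hu : ((m : ℤ) + n) ∣ u - F.top.peak
    · rw [hpk u hu]; exact hq.le_top u
    · rw [hpq u hu]
  have hp : F.Member p := by
    intro u
    by_cases hu : ((m : ℤ) + n) ∣ u - F.top.peak
    · exact Or.inl (hpk u hu)
    · rw [hpq u hu, ← toggle_bot_of_not_dvd F hu]; exact hq u
  by_cases h1 : ((m : ℤ) + n) ∣ t - F.top.peak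
  · have hc := F.top_corner_of_dvd_sub_peak h1
    have hlegs := hF _ F.member_top
    have hqt : F.top.y t ≤ q.y (t + 1) := by
      have h2 : F.toggle.bot.y t = F.top.y t - 1 := by
        rw [toggle_bot_of_dvd F h1, bot_eq_top_of_dvd hfl h1]; ring
      have := hq t
      rw [toggle_top] at this
      omega
    refine ((hq.le_top _).trans ?_).trans hqt
    rw [toggle_top]
    by_contra hlt
    -- otherwise the next leg of the top path starts at most `g` steps after the highest vertex
    have h2 := hlegs (t - 1) (by rw [sub_add_cancel]; exact hc.1) k hk1 hkg
    rw [sub_add_cancel] at h2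
    have h3 := F.top.step_le (t - 1 + k)
    rw [show t - 1 + (k : ℤ) + 1 = t + k by ring] at h3
    have h4 : F.top.y (t + k) = F.top.y t + 1 := by omega
    obtain ⟨j, hj⟩ := h1
    have h5 : F.top.height t = F.top.height F.top.peak := by
      rw [← F.top.height_periodic F.top.peak j, ← hj]; congr 1; ring
    have h6 := F.top.height_le_peak (t + k)
    rw [← h5] at h6
    simp only [GridPath.height, h4] at h6
    have h7 : (n : ℤ) * k ≤ n * g := by gcongr
    refine (not_wide_iff F).2 (thin_of_legsAtLeast hF ?_) hw
    zify
    linarith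
  by_cases h2 : ((m : ℤ) + n) ∣ t + 1 - F.top.peak
  · have hc := F.top_corner_of_dvd_sub_peak h2
    rw [add_sub_cancel_right] at hc
    have h3 : F.toggle.bot.y (t + 1) = F.top.y (t + 1) - 1 := by
      rw [toggle_bot_of_dvd F h2, bot_eq_top_of_dvd hfl h2]; ring
    have hq1 := hq (t + 1)
    have hq0 := hq.le_top t
    rw [toggle_top] at hq1 hq0
    rcases hq1 with e | e
    · rw [← hpq t h1] at ht
      have h4 : q.y (t + 1) = p.y (t + 1) := by rw [hpk _ h2, e]
      rw [h4] at ht ⊢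
      exact (hle _).trans (hF p hp t ht k hk1 hkg).le
    · -- after the flip there is no northbound edge into the flipped vertex
      exfalso
      have hb : F.toggle.bot.y t = F.top.y t := by
        by_contra hne
        have := F.toggle.apart t hne
        rw [toggle_top] at this
        omega
      have := hq t
      rw [toggle_top] at this
      omega
  · rw [← hpq t h1, ← hpq _ h2] at ht
    rw [← hpq _ h2]
    exact (hle _).trans (hF p hp t ht k hk1 hkg).le

end GridFlip

/-! ### Coverings of complexes of flips and the collapse onto the thin flips -/

theorem sum_range_pos_of_periodic {N : ℕ} (hN : 0 < N) {d : ℤ → ℤ}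
    (hper : Function.Periodic d (N : ℤ)) (h0 : ∀ t, 0 ≤ d t) (hne : ∃ t, d t ≠ 0) :
    0 < ∑ i ∈ Finset.range N, d i := by
  obtain ⟨t, ht⟩ := hne
  have hN' : (0 : ℤ) < N := by exact_mod_cast hN
  refine Finset.sum_pos' (fun i _ => h0 _) ⟨(t % N).toNat, ?_, ?_⟩
  · rw [Finset.mem_range]
    have := Int.emod_lt_of_pos t hN'
    omega
  · rw [Int.toNat_of_nonneg (Int.emod_nonneg _ hN'.ne')]
    refine lt_of_le_of_ne (h0 _) (Ne.symm ?_)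
    have h1 := hper.int_mul (t / N) (t % N)
    rw [Int.cast_id, mul_comm, Int.emod_add_mul_ediv] at h1
    rwa [← h1]

namespace GridFlip

variable {m n : ℕ}

theorem forall_member_shift_legsAtLeast {F : GridFlip m n} {g : ℕ}
    (h : ∀ p, F.Member p → p.LegsAtLeast g) (k : ℤ) (p : GridPath m n)
    (hp : (F.shift k).Member p) : p.LegsAtLeast g := by
  have h1 := GridPath.legsAtLeast_shift (h _ (member_shift.1 hp)) k
  have h2 : (p.shift (-k)).shift k = p := by ext t; simp [GridPath.shift]
  rwa [h2] at h1

variable [NeZero m]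

theorem finite_setOf_top_mem (b : ℕ) :
    {F : GridFlip m n | 0 ≤ F.top.y 0 ∧ F.top.y 0 < b}.Finite := by
  have hN : (0 : ℤ) < m + n := GridPath.size_pos
  let f : GridFlip m n → (Fin (m + n) → ℤ × ℤ) := fun F i => (F.top.y i, F.bot.y i)
  have hinj : Function.Injective f := by
    intro F G h
    have key : ∀ t : ℤ, F.top.y (t % (m + n)) = G.top.y (t % (m + n)) ∧
        F.bot.y (t % (m + n)) = G.bot.y (t % (m + n)) := by
      intro t
      obtain ⟨i, hi⟩ := Int.eq_ofNat_of_zero_le (Int.emod_nonneg t hN.ne')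
      have hlt := Int.emod_lt_of_pos t hN
      have := congr_fun h ⟨i, by omega⟩
      rw [hi]
      exact Prod.ext_iff.1 this
    ext t
    · rw [← Int.emod_add_mul_ediv t (m + n), GridPath.y_add_mul, GridPath.y_add_mul, (key t).1]
    · rw [← Int.emod_add_mul_ediv t (m + n), GridPath.y_add_mul, GridPath.y_add_mul, (key t).2]
  refine ((Set.Finite.pi' fun _ : Fin (m + n) => (Set.finite_Icc (-1 : ℤ) (b + m + n)).prod
    (Set.finite_Icc (-1 : ℤ) (b + m + n))).preimage hinj.injOn).subset ?_
  rintro F ⟨h0, h1⟩ i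
  have e1 := F.top.y_add_le 0 i
  have e2 := F.top.y_monotone (show (0 : ℤ) ≤ i by omega)
  have e3 := F.bot_eq i
  have e4 := i.2
  rw [zero_add] at e1
  simp only [f, Set.mem_prod, Set.mem_Icc]
  omega

theorem forall_member_shift_thin {F : GridFlip m n} (h : ∀ p, F.Member p → p.Thin) (k : ℤ)
    (p : GridPath m n) (hp : (F.shift k).Member p) : p.Thin :=
  (GridPath.thin_shift p (-k)).1 (h _ (member_shift.1 hp))

variable [NeZero n]

/-- The second coordinates of the bottom path of the larger one of the two flips that are matched
with each other. -/
noncomputable def low (F : GridFlip m n) (t : ℤ) : ℤ := min (F.bot.y t) (F.toggle.bot.y t)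

theorem low_toggle (F : GridFlip m n) : F.toggle.low = F.low := by
  funext t
  rw [low, low, toggle_toggle, min_comm]

theorem low_of_dvd (F : GridFlip m n) {t : ℤ} (ht : ((m : ℤ) + n) ∣ t - F.top.peak) :
    F.low t = F.top.y t - 1 := by
  rw [low, toggle_bot_of_dvd F ht]
  have := F.bot_eq t
  omega

theorem low_of_not_dvd (F : GridFlip m n) {t : ℤ} (ht : ¬ ((m : ℤ) + n) ∣ t - F.top.peak) :
    F.low t = F.bot.y t := by
  rw [low, toggle_bot_of_not_dvd F ht, min_self]

theorem low_shift (F : GridFlip m n) (k t : ℤ) : (F.shift k).low t = F.low t + k := by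
  rw [low, low, toggle_shift]
  simp only [shift, GridPath.shift]
  omega

theorem low_periodic (F : GridFlip m n) (t : ℤ) : F.low (t + (m + n)) = F.low t + n := by
  rw [low, low, GridPath.periodic, GridPath.periodic]
  omega

theorem eq_of_low_eq {F G : GridFlip m n} (hF : ¬ F.PeakFlipped) (hG : ¬ G.PeakFlipped)
    (htop : F.top = G.top) (hlow : F.low = G.low) : F = G := by
  ext t
  · rw [htop]
  · by_cases h : ((m : ℤ) + n) ∣ t - F.top.peak
    · rw [bot_eq_top_of_dvd hF h, bot_eq_top_of_dvd hG (by rwa [← htop]), htop]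
    · rw [← low_of_not_dvd F h, hlow, low_of_not_dvd G (by rwa [← htop])]

/-- The rank by which the pairs of matched flips are ordered lexicographically: pairs of higher rank
are collapsed earlier. The height of the lowest vertices is subtracted in the first component to
make it invariant under translation; without it, moving down the top path could lead around the
band. The second component compares flips with the same top path. -/
noncomputable def rank (F : GridFlip m n) : ℤ ×ₗ ℤ :=
  toLex (∑ i ∈ Finset.range (m + n), F.top.y i - F.bot.floor,
    ∑ i ∈ Finset.range (m + n), (F.top.y i - F.low i))

theorem rank_shift (F : GridFlip m n) (k : ℤ) : (F.shift k).rank = F.rank := by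
  have h1 : (F.shift k).bot.floor = F.bot.floor + (m + n) * k := F.bot.floor_shift k
  simp only [rank, low_shift, h1]
  simp only [shift, GridPath.shift, Finset.sum_add_distrib, Finset.sum_const, Finset.card_range,
    nsmul_eq_mul, add_sub_add_right_eq_sub, Nat.cast_add]

theorem rank_toggle {F : GridFlip m n} (h : F.Wide) : F.toggle.rank = F.rank := by
  simp only [rank, low_toggle, toggle_top, floor_toggle h]

theorem rank_lt_rank {F G : GridFlip m n} (hF : ¬ F.PeakFlipped) (hle : F ≤ G) (hne : F ≠ G)
    (hnt : G ≠ F.toggle) : F.rank < G.rank := by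
  have hN : (0 : ℤ) < m + n := GridPath.size_pos
  have hN' : 0 < m + n := by exact_mod_cast hN
  have hfloor : G.bot.floor ≤ F.bot.floor := by
    obtain ⟨t, ht⟩ := F.bot.exists_height_eq_floor
    rw [← ht]
    refine (G.bot.floor_le t).trans ?_
    have := mul_le_mul_of_nonneg_left (le_bot hle t) hN.le
    simp only [GridPath.height]
    linarith
  rw [rank, rank, Prod.Lex.toLex_lt_toLex]
  by_cases htop : F.top = G.top
  · have h2 : 0 < ∑ i ∈ Finset.range (m + n), (F.low i - G.low i) := by
      refine sum_range_pos_of_periodic hN' (d := fun t => F.low t - G.low t) ?_ ?_ ?_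
      · intro t
        push_cast
        rw [low_periodic, low_periodic]; ring
      · intro t
        rw [sub_nonneg]
        by_cases h : ((m : ℤ) + n) ∣ t - F.top.peak
        · rw [low_of_dvd F h, low_of_dvd G (by rwa [← htop]), htop]
        · rw [low_of_not_dvd F h, low_of_not_dvd G (by rwa [← htop])]
          exact le_bot hle t
      · by_contra hall
        have hlow : F.low = G.low := by
          funext t
          have := not_exists.1 hall t
          omega
        by_cases hG : G.PeakFlipped
        · refine hnt ?_
          rw [eq_of_low_eq hF (G := G.toggle) (by rw [peakFlipped_toggle]; exact not_not.2 hG) htop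
            (by rw [low_toggle, hlow]), toggle_toggle]
        · exact hne (eq_of_low_eq hF hG htop hlow)
    rw [Finset.sum_sub_distrib] at h2
    rw [Finset.sum_sub_distrib, Finset.sum_sub_distrib, htop]
    dsimp only
    omega
  · have h2 : 0 < ∑ i ∈ Finset.range (m + n), (G.top.y i - F.top.y i) := by
      refine sum_range_pos_of_periodic hN' (d := fun t => G.top.y t - F.top.y t) ?_ ?_ ?_
      · intro t
        push_cast
        rw [GridPath.periodic, GridPath.periodic]; ring
      · exact fun t => sub_nonneg.2 (top_le hle t)
      · by_contra hall
        refine htop (GridPath.ext (funext fun t => ?_))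
        have := not_exists.1 hall t
        omega
    rw [Finset.sum_sub_distrib] at h2
    left
    dsimp only
    omega

end GridFlip

/-- The maps `π a` from flips of grid paths to the cells of a complex identify exactly the translates
by multiples of `(-b, b)`, they have disjoint images for different indices `a`, and the face
relation of the complex is the one induced from the flips. -/
structure IsBandCover {m n : ℕ} {ι C : Type*} [PartialOrder C] (b : ℕ)
    (π : ι → GridFlip m n → C) : Prop where
  le_iff : ∀ a a' F G, π a F ≤ π a' G ↔ a = a' ∧ ∃ k : ℤ, F.shift (k * b) ≤ G

namespace IsBandCover

open GridFlip

variable {m n : ℕ} {ι C : Type*} [PartialOrder C] {b : ℕ} {π : ι → GridFlip m n → C}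

theorem eq_iff (hπ : IsBandCover b π) {a a' : ι} {F G : GridFlip m n} :
    π a F = π a' G ↔ a = a' ∧ ∃ k : ℤ, F.shift (k * b) = G := by
  constructor
  · intro h
    obtain ⟨ha, k, hk⟩ := (hπ.le_iff _ _ _ _).1 h.le
    obtain ⟨-, l, hl⟩ := (hπ.le_iff _ _ _ _).1 h.ge
    refine ⟨ha, k, le_antisymm' hk ?_⟩
    have h1 := top_le hk 0
    have h2 := top_le hl 0
    have h3 := le_bot hk 0
    have h4 := le_bot hl 0
    simp only [shift, GridPath.shift] at h1 h2 h3 h4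
    have e : l * (b : ℤ) = -(k * b) := by omega
    rw [e] at hl
    have h5 := shift_le_shift hl (k * b)
    rwa [shift_shift, neg_add_cancel, shift_zero] at h5
  · rintro ⟨rfl, k, rfl⟩
    refine le_antisymm ((hπ.le_iff _ _ _ _).2 ⟨rfl, k, fun _ h => h⟩)
      ((hπ.le_iff _ _ _ _).2 ⟨rfl, -k, ?_⟩)
    rw [shift_shift, neg_mul, add_neg_cancel, shift_zero]
    exact fun _ h => h

theorem shift_eq (hπ : IsBandCover b π) (a : ι) (F : GridFlip m n) (k : ℤ) :
    π a (F.shift (k * b)) = π a F :=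
  (hπ.eq_iff.2 ⟨rfl, k, rfl⟩).symm

theorem le_of_le (hπ : IsBandCover b π) (a : ι) {F G : GridFlip m n} (h : F ≤ G) :
    π a F ≤ π a G :=
  (hπ.le_iff _ _ _ _).2 ⟨rfl, 0, by rwa [zero_mul, shift_zero]⟩

/-- The cells of the complex given by flips with legs of length at least `g`. -/
def legSet (π : ι → GridFlip m n → C) (g : ℕ) : Set C :=
  {c | ∃ a F, π a F = c ∧ ∀ p, F.Member p → p.LegsAtLeast g}

/-- The cells of the complex given by thin flips with legs of length at least `g`. -/
def thinSet (π : ι → GridFlip m n → C) (g : ℕ) : Set C :=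
  {c | ∃ a F, π a F = c ∧ (∀ p, F.Member p → p.LegsAtLeast g) ∧ ∀ p, F.Member p → p.Thin}

variable [NeZero m]

theorem finite_legSet (hπ : IsBandCover b π) [Finite ι] (hb : 0 < b) (g : ℕ) :
    (legSet π g).Finite := by
  refine (Set.Finite.image2 π Set.finite_univ (finite_setOf_top_mem (m := m) (n := n) b)).subset ?_
  rintro _ ⟨a, F, rfl, -⟩
  have hb' : (0 : ℤ) < b := by exact_mod_cast hb
  refine ⟨a, trivial, F.shift (-(F.top.y 0 / b) * b), ?_, hπ.shift_eq _ _ _⟩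
  have h1 := Int.emod_add_mul_ediv (F.top.y 0) b
  have h2 := Int.emod_nonneg (F.top.y 0) hb'.ne'
  have h3 := Int.emod_lt_of_pos (F.top.y 0) hb'
  have h4 : (F.shift (-(F.top.y 0 / b) * b)).top.y 0 = F.top.y 0 % b := by
    simp only [shift, GridPath.shift]
    linarith
  simp only [Set.mem_ofPred_eq, h4]
  exact ⟨h2, h3⟩

variable [NeZero n]

theorem mem_legSet_diff_thinSet (hπ : IsBandCover b π) {a : ι} {F : GridFlip m n} {g : ℕ} :
    π a F ∈ legSet π g \ thinSet π g ↔ (∀ p, F.Member p → p.LegsAtLeast g) ∧ F.Wide := by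
  have hleg : π a F ∈ legSet π g → ∀ p, F.Member p → p.LegsAtLeast g := by
    rintro ⟨a', G, h, hG⟩
    obtain ⟨rfl, k, rfl⟩ := hπ.eq_iff.1 h
    exact forall_member_shift_legsAtLeast hG _
  constructor
  · rintro ⟨h, h'⟩
    refine ⟨hleg h, ?_⟩
    by_contra hw
    exact h' ⟨a, F, rfl, hleg h, (not_wide_iff F).1 hw⟩
  · rintro ⟨h, hw⟩
    refine ⟨⟨a, F, rfl, h⟩, ?_⟩
    rintro ⟨a', G, h', -, hG⟩
    obtain ⟨rfl, k, rfl⟩ := hπ.eq_iff.1 h'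
    exact (not_wide_iff _).2 (forall_member_shift_thin hG _) hw

/-- The flips that are not thin are matched by toggling a highest vertex, and collapsed in the
order of decreasing rank. -/
theorem collapsesTo (hπ : IsBandCover b π) [Finite ι] (hb : 0 < b) (g : ℕ) :
    CollapsesTo (legSet π g) (thinSet π g) := by
  let P : ι × GridFlip m n → C := fun x => π x.1 x.2
  have hμ : Function.FactorsThrough (fun x : ι × GridFlip m n => π x.1 x.2.toggle) P := by
    rintro ⟨a, F⟩ ⟨a', G⟩ h
    obtain ⟨rfl, k, rfl⟩ := hπ.eq_iff.1 h
    dsimp only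
    rw [toggle_shift, hπ.shift_eq]
  have hr : Function.FactorsThrough (fun x : ι × GridFlip m n => x.2.rank) P := by
    rintro ⟨a, F⟩ ⟨a', G⟩ h
    obtain ⟨rfl, k, rfl⟩ := hπ.eq_iff.1 h
    dsimp only
    rw [rank_shift]
  let μ : C → C := Function.extend P (fun x => π x.1 x.2.toggle) id
  let f : C → ℤ ×ₗ ℤ := Function.extend P (fun x => x.2.rank) fun _ => toLex (0, 0)
  have hμ' : ∀ a F, μ (π a F) = π a F.toggle := fun a F => hμ.extend_apply id (a, F)
  have hr' : ∀ a F, f (π a F) = F.rank := fun a F => hr.extend_apply _ (a, F)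
  have hlt : ∀ a (F : GridFlip m n), ¬ F.PeakFlipped → π a F < π a F.toggle := by
    intro a F hF
    refine lt_of_le_of_ne (hπ.le_of_le a (le_toggle hF)) fun h => ?_
    obtain ⟨-, k, hk⟩ := hπ.eq_iff.1 h
    have h1 : F.shift (k * b) = F.toggle := hk
    have h2 : F.toggle.PeakFlipped := (peakFlipped_toggle F).2 hF
    rw [← h1] at h2
    have hpk : (F.shift (k * b)).top.peak = F.top.peak := F.top.peak_shift _
    rw [PeakFlipped, hpk] at h2
    refine hF fun h3 => h2 ?_
    simp only [shift, GridPath.shift, h3]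
  refine collapsesTo_of_involution _ _ ?_ ((hπ.finite_legSet hb g).subset Set.sdiff_subset) μ f
    ?_ ?_ ?_ ?_ ?_
  · rintro _ ⟨a, F, rfl, h, -⟩
    exact ⟨a, F, rfl, h⟩
  · rintro c hc
    obtain ⟨a, F, rfl, -⟩ := hc.1
    rw [hμ']
    rw [hπ.mem_legSet_diff_thinSet] at hc ⊢
    exact ⟨legsAtLeast_toggle hc.2 hc.1, wide_toggle hc.2⟩
  · rintro _ ⟨⟨a, F, rfl, -⟩, -⟩
    rw [hμ', hμ', toggle_toggle]
  · rintro _ ⟨⟨a, F, rfl, -⟩, -⟩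
    rw [hμ']
    by_cases hF : F.PeakFlipped
    · right
      have := hlt a F.toggle (by rw [peakFlipped_toggle]; exact not_not.2 hF)
      rwa [toggle_toggle] at this
    · exact Or.inl (hlt a F hF)
  · rintro c hc
    obtain ⟨a, F, rfl, -⟩ := hc.1
    rw [hπ.mem_legSet_diff_thinSet] at hc
    rw [hμ', hr', hr', rank_toggle hc.2]
  · rintro c hc hcμ ρ hρ hcρ hne
    obtain ⟨a, F, rfl, -⟩ := hc.1
    rw [hπ.mem_legSet_diff_thinSet] at hc
    rw [hμ'] at hcμ hne
    have hF : ¬ F.PeakFlipped := fun hF => not_le_of_gt hcμ (hπ.le_of_le a (toggle_le hF))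
    obtain ⟨a', G, rfl, hG⟩ := hρ
    obtain ⟨rfl, k, hk⟩ := (hπ.le_iff _ _ _ _).1 hcρ.le
    rw [hr', hr']
    -- replace the first flip by the translate that is a face of the second one
    rw [← hπ.shift_eq a F k] at hcρ
    rw [← hπ.shift_eq a F.toggle k, ← toggle_shift] at hne
    rw [← rank_shift F (k * b)]
    have hF' : ¬ (F.shift (k * b)).PeakFlipped := fun h => h <| by
      have hpk : (F.shift (k * b)).top.peak = F.top.peak := F.top.peak_shift _
      rw [hpk]
      simp only [shift, GridPath.shift, not_not.1 hF]
    refine ⟨?_, rank_lt_rank hF' hk (fun h => hcρ.ne (by rw [h])) (fun h => hne (by rw [h]))⟩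
    have hw : G.Wide := by
      by_contra hG'
      rw [not_wide_iff] at hG'
      refine (not_wide_iff F).2 (fun p hp => ?_) hc.2
      rw [← GridPath.thin_shift p (k * b)]
      refine hG' _ (hk _ (member_shift.2 ?_))
      have : (p.shift (k * b)).shift (-(k * b)) = p := by ext t; simp [GridPath.shift]
      rwa [this]
    exact ((hπ.mem_legSet_diff_thinSet (a := a)).2 ⟨hG, hw⟩).2

end IsBandCover

/-- The orbit map onto the band flips is a covering with a single index. -/
theorem isBandCover_mk (b m n : ℕ) :
    IsBandCover b (fun (_ : Unit) (F : GridFlip m n) => BandFlip.mk b F) where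
  le_iff a a' F G := by
    simp only [true_and]
    constructor
    · rintro ⟨F', G', hF, hG, h⟩
      obtain ⟨k, rfl⟩ := BandFlip.mk_eq_mk.1 hF.symm
      obtain ⟨l, rfl⟩ := BandFlip.mk_eq_mk.1 hG
      refine ⟨k + l, ?_⟩
      have := GridFlip.shift_le_shift h (l * b)
      rwa [GridFlip.shift_shift, ← add_mul] at this
    · rintro ⟨k, h⟩
      exact ⟨_, G, (BandFlip.mk_eq_mk.2 ⟨k, rfl⟩).symm, rfl, h⟩

theorem collapsesTo_thinTorusFrontComplex {b m n : ℕ} (g : ℕ) (hb : 0 < b) [NeZero m] [NeZero n] :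
    CollapsesTo (torusFrontComplex b m n g) (thinTorusFrontComplex b m n g) := by
  have h := (isBandCover_mk b m n).collapsesTo hb g
  have e1 : IsBandCover.legSet (fun (_ : Unit) (F : GridFlip m n) => BandFlip.mk b F) g =
      torusFrontComplex b m n g := by
    ext c
    exact ⟨fun ⟨_, F, h⟩ => ⟨F, h⟩, fun ⟨F, h⟩ => ⟨(), F, h⟩⟩
  have e2 : IsBandCover.thinSet (fun (_ : Unit) (F : GridFlip m n) => BandFlip.mk b F) g =
      thinTorusFrontComplex b m n g := by
    ext c
    constructor
    · rintro ⟨_, F, rfl, h1, h2⟩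
      exact ⟨⟨F, rfl, h1⟩, F, rfl, h2⟩
    · rintro ⟨⟨F, rfl, h1⟩, G, hG, h2⟩
      obtain ⟨k, rfl⟩ := BandFlip.mk_eq_mk.1 hG
      refine ⟨(), _, hG, ?_, h2⟩
      have := GridFlip.forall_member_shift_legsAtLeast h1 (-(k * b))
      rwa [GridFlip.shift_shift, add_neg_cancel, GridFlip.shift_zero] at this
  rwa [e1, e2] at h

/-! ### The cubes of thin flips -/

theorem le_of_mul_lt_mul_add {N x y : ℤ} (hN : 0 < N) (h : N * x < N * y + N) : x ≤ y :=
  Int.lt_add_one_iff.1 (lt_of_mul_lt_mul_left (by rwa [mul_add, mul_one]) hN.le)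

namespace GridFlip

variable {m n : ℕ}

/-- The flip without flipped corners. -/
def single (p : GridPath m n) : GridFlip m n := ⟨p, p, fun _ h => absurd rfl h, fun _ _ => rfl⟩

theorem gcd_dvd_height (p : GridPath m n) (t : ℤ) : (Nat.gcd m n : ℤ) ∣ p.height t := by
  have h1 : (Nat.gcd m n : ℤ) ∣ m := by exact_mod_cast Nat.gcd_dvd_left m n
  have h2 : (Nat.gcd m n : ℤ) ∣ n := by exact_mod_cast Nat.gcd_dvd_right m n
  exact dvd_sub (((dvd_add h1 h2).mul_right _)) (h2.mul_right _)

theorem exists_dvd_add_mul {c : ℤ} (hc : (Nat.gcd m n : ℤ) ∣ c) :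
    ∃ t : ℤ, ((m : ℤ) + n) ∣ c + n * t := by
  have h : (Int.gcd (n : ℤ) (m + n) : ℤ) ∣ c := by
    have : Int.gcd (n : ℤ) (m + n) = Nat.gcd m n := by
      rw [← Nat.cast_add, Int.gcd_natCast_natCast, Nat.gcd_add_self_right, Nat.gcd_comm]
    rwa [this]
  obtain ⟨j, rfl⟩ := h
  refine ⟨-(Int.gcdA n (m + n) * j), Int.gcdB n (m + n) * j, ?_⟩
  rw [Int.gcd_eq_gcd_ab]
  ring

variable [NeZero m]

theorem gcd_pos : (0 : ℤ) < Nat.gcd m n := by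
  exact_mod_cast Nat.gcd_pos_of_pos_left n (NeZero.pos m)

theorem eq_of_height_mem_Ioc {p q : GridPath m n} {c : ℤ}
    (hp : ∀ t, c < p.height t ∧ p.height t ≤ c + (m + n))
    (hq : ∀ t, c < q.height t ∧ q.height t ≤ c + (m + n)) : p = q := by
  have hN : (0 : ℤ) < m + n := GridPath.size_pos
  ext t
  have h1 := hp t
  have h2 := hq t
  simp only [GridPath.height] at h1 h2
  exact le_antisymm (le_of_mul_lt_mul_add hN (by linarith))
    (le_of_mul_lt_mul_add hN (by linarith))

/-- The number of flipped corners of a cube. -/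
theorem card_dvd_add_mul {c : ℤ} (hc : (Nat.gcd m n : ℤ) ∣ c) :
    ((Finset.Ico (0 : ℤ) (m + n)).filter fun t => ((m : ℤ) + n) ∣ c + n * t).card =
      Nat.gcd m n := by
  have hd := gcd_pos (m := m) (n := n)
  have hN : (0 : ℤ) < m + n := GridPath.size_pos
  obtain ⟨t₀, h₀⟩ := exists_dvd_add_mul hc
  set d := Nat.gcd m n with hddef
  obtain ⟨N', hN'⟩ : (d : ℤ) ∣ m + n := by
    exact_mod_cast dvd_add (Nat.gcd_dvd_left m n) (Nat.gcd_dvd_right m n)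
  obtain ⟨n', hn'⟩ : (d : ℤ) ∣ n := by exact_mod_cast Nat.gcd_dvd_right m n
  have hN'pos : 0 < N' := pos_of_mul_pos_right (a := (d : ℤ)) (by rw [← hN']; exact hN) hd.le
  have hcop : IsCoprime N' n' := by
    rw [Int.isCoprime_iff_gcd_eq_one]
    have h1 : Int.gcd ((m : ℤ) + n) n = d := by
      rw [← Nat.cast_add, Int.gcd_natCast_natCast, hddef, Nat.gcd_add_self_left]
    rw [hN', hn', Int.gcd_mul_left, Int.natAbs_natCast] at h1
    exact Nat.eq_of_mul_eq_mul_left (by exact_mod_cast hd) (by rw [h1, mul_one])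
  have hiff : ∀ t : ℤ, ((m : ℤ) + n) ∣ c + n * t ↔ t ≡ t₀ [ZMOD N'] := by
    intro t
    rw [Int.modEq_comm, Int.modEq_iff_dvd]
    have h1 : c + n * t = c + n * t₀ + n * (t - t₀) := by ring
    rw [h1, dvd_add_right h₀, hN', hn', mul_assoc, mul_dvd_mul_iff_left hd.ne']
    exact ⟨hcop.dvd_of_dvd_mul_left, fun h => h.mul_left _⟩
  simp only [hiff]
  have h2 := Int.Ico_filter_modEq_card 0 ((m : ℤ) + n) hN'pos t₀
  have hQ : (N' : ℚ) ≠ 0 := by exact_mod_cast hN'pos.ne'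
  have h3 : (((m : ℤ) + n : ℤ) - t₀ : ℚ) / N' = (0 - t₀ : ℚ) / N' + (d : ℤ) := by
    rw [hN']; push_cast; field_simp; ring
  rw [Int.cast_zero] at h2
  rw [h3, Int.ceil_add_intCast] at h2
  omega

variable [NeZero n]

/-- The path whose heights lie in the half-open interval from `c + 1` to `c + m + n`. -/
def stripPath (m n : ℕ) [NeZero m] [NeZero n] (c : ℤ) : GridPath m n where
  y t := (c + n * t) / (m + n) + 1
  step t := by
    have hm := NeZero.pos m
    have hN : (0 : ℤ) < m + n := GridPath.size_pos
    have h1 := Int.emod_add_mul_ediv (c + n * t) (m + n)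
    have h2 := Int.emod_nonneg (c + n * t) hN.ne'
    have h3 := Int.emod_lt_of_pos (c + n * t) hN
    have h4 := Int.emod_add_mul_ediv (c + n * (t + 1)) (m + n)
    have h5 := Int.emod_nonneg (c + n * (t + 1)) hN.ne'
    have h6 := Int.emod_lt_of_pos (c + n * (t + 1)) hN
    have h7 : (c + n * (t + 1)) / ((m : ℤ) + n) ≤ (c + n * t) / (m + n) + 1 :=
      le_of_mul_lt_mul_add hN (by linarith)
    have h8 : (c + n * t) / ((m : ℤ) + n) ≤ (c + n * (t + 1)) / (m + n) :=
      le_of_mul_lt_mul_add hN (by linarith)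
    omega
  periodic t := by
    have hN : (0 : ℤ) < m + n := GridPath.size_pos
    rw [show c + (n : ℤ) * (t + (m + n)) = c + n * t + (m + n) * n by ring,
      Int.add_mul_ediv_left _ _ hN.ne']
    ring

theorem lt_height_stripPath (c t : ℤ) : c < (stripPath m n c).height t := by
  have hN : (0 : ℤ) < m + n := GridPath.size_pos
  have h1 := Int.emod_add_mul_ediv (c + n * t) (m + n)
  have h3 := Int.emod_lt_of_pos (c + n * t) hN
  simp only [GridPath.height, stripPath]
  linarith

theorem height_stripPath_le (c t : ℤ) : (stripPath m n c).height t ≤ c + (m + n) := by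
  have hN : (0 : ℤ) < m + n := GridPath.size_pos
  have h1 := Int.emod_add_mul_ediv (c + n * t) (m + n)
  have h2 := Int.emod_nonneg (c + n * t) hN.ne'
  simp only [GridPath.height, stripPath]
  linarith

/-- The flip whose members are all the paths with heights between `c` and `c + m + n`. If `c` is a
multiple of `d = gcd m n`, then `d` corners are flipped, namely the ones where the height can
be `c` or `c + m + n`; all other heights are determined by their residues. -/
noncomputable def cube (m n : ℕ) [NeZero m] [NeZero n] (c : ℤ) : GridFlip m n :=
  ofCorners (stripPath m n c) {t | ((m : ℤ) + n) ∣ c + n * t}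
    (fun t => by
      simp only [Set.mem_ofPred_eq]
      rw [show c + (n : ℤ) * (t + (m + n)) = c + n * t + (m + n) * n by ring,
        dvd_add_left (Dvd.intro _ rfl)])
    (fun t ht => by
      have hN : (0 : ℤ) < m + n := GridPath.size_pos
      obtain ⟨j, hj⟩ := ht
      have h0 : (stripPath m n c).height t = c + (m + n) := by
        simp only [GridPath.height, stripPath, hj, Int.mul_ediv_cancel_left _ hN.ne']
        linarith
      refine GridPath.corner_of_forall_height_le fun s => ?_
      rw [h0]
      exact height_stripPath_le c s)

@[simp] theorem cube_top (c : ℤ) : (cube m n c).top = stripPath m n c := rfl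

theorem height_cube_bot_of_dvd {c t : ℤ} (h : ((m : ℤ) + n) ∣ c + n * t) :
    (cube m n c).bot.height t = c := by
  have hN : (0 : ℤ) < m + n := GridPath.size_pos
  have h1 : (cube m n c).bot.y t = (stripPath m n c).y t - 1 := ofCorners_bot_of_mem h
  obtain ⟨j, hj⟩ := h
  simp only [GridPath.height, h1, stripPath, hj, Int.mul_ediv_cancel_left _ hN.ne']
  linarith

theorem cube_bot_of_not_dvd {c t : ℤ} (h : ¬ ((m : ℤ) + n) ∣ c + n * t) :
    (cube m n c).bot.y t = (stripPath m n c).y t := ofCorners_bot_of_notMem h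

theorem height_stripPath_of_dvd {c t : ℤ} (h : ((m : ℤ) + n) ∣ c + n * t) :
    (stripPath m n c).height t = c + (m + n) := by
  have h1 : (cube m n c).bot.y t = (stripPath m n c).y t - 1 := ofCorners_bot_of_mem h
  have h2 := height_cube_bot_of_dvd h
  simp only [GridPath.height, h1] at h2 ⊢
  linarith

theorem le_height_cube_bot (c t : ℤ) : c ≤ (cube m n c).bot.height t := by
  by_cases h : ((m : ℤ) + n) ∣ c + n * t
  · exact (height_cube_bot_of_dvd h).ge
  · rw [GridPath.height, cube_bot_of_not_dvd h]
    exact (lt_height_stripPath c t).le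

theorem height_cube_bot_lt (c t : ℤ) : (cube m n c).bot.height t < c + (m + n) := by
  have hN : (0 : ℤ) < m + n := GridPath.size_pos
  by_cases h : ((m : ℤ) + n) ∣ c + n * t
  · rw [height_cube_bot_of_dvd h]
    omega
  · refine lt_of_le_of_ne ?_ fun h' => h ⟨(cube m n c).bot.y t - 1, ?_⟩
    · rw [GridPath.height, cube_bot_of_not_dvd h]
      exact height_stripPath_le c t
    · rw [GridPath.height] at h'
      linear_combination -h'

theorem le_cube_iff {F : GridFlip m n} {c : ℤ} : F ≤ cube m n c ↔
    (∀ t, F.top.height t ≤ c + (m + n)) ∧ ∀ t, c ≤ F.bot.height t := by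
  have hN : (0 : ℤ) < m + n := GridPath.size_pos
  rw [le_iff]
  constructor
  · rintro ⟨h1, h2⟩
    constructor
    · intro t
      have e1 := mul_le_mul_of_nonneg_left (h1 t) hN.le
      have e2 := height_stripPath_le (m := m) (n := n) c t
      rw [cube_top] at e1
      simp only [GridPath.height] at e2 ⊢
      linarith
    · intro t
      have e1 := mul_le_mul_of_nonneg_left (h2 t) hN.le
      have e2 := le_height_cube_bot (m := m) (n := n) c t
      simp only [GridPath.height] at e2 ⊢
      linarith
  · rintro ⟨h1, h2⟩
    constructor
    · intro t
      have e1 := h1 t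
      have e2 := lt_height_stripPath (m := m) (n := n) c t
      simp only [GridPath.height] at e1 e2
      exact le_of_mul_lt_mul_add hN (by rw [cube_top]; linarith)
    · intro t
      have e1 := h2 t
      have e2 := height_cube_bot_lt (m := m) (n := n) c t
      simp only [GridPath.height] at e1 e2
      exact le_of_mul_lt_mul_add hN (by linarith)

theorem shift_le_cube_iff {F : GridFlip m n} {c k : ℤ} :
    F.shift k ≤ cube m n (c + (m + n) * k) ↔ F ≤ cube m n c := by
  have h1 : ∀ t, (F.shift k).top.height t = F.top.height t + (m + n) * k := F.top.height_shift k
  have h2 : ∀ t, (F.shift k).bot.height t = F.bot.height t + (m + n) * k := F.bot.height_shift k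
  simp only [le_cube_iff, h1, h2, add_le_add_iff_right, add_right_comm c]

theorem cube_shift (c k : ℤ) : (cube m n c).shift k = cube m n (c + (m + n) * k) := by
  refine le_antisymm' (shift_le_cube_iff.2 fun _ h => h) ?_
  have : cube m n (c + (m + n) * k) = ((cube m n (c + (m + n) * k)).shift (-k)).shift k := by
    rw [shift_shift, neg_add_cancel, shift_zero]
  rw [this]
  refine shift_le_shift ?_ k
  rw [show cube m n c = cube m n (c + (m + n) * k + (m + n) * -k) by congr 1; ring,
    shift_le_cube_iff]
  exact fun _ h => h

theorem exists_le_cube {F : GridFlip m n} (h : ∀ p, F.Member p → p.Thin) :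
    ∃ k : ℤ, F ≤ cube m n (Nat.gcd m n * k) := by
  obtain ⟨t, ht⟩ := F.bot.exists_height_eq_floor
  obtain ⟨k, hk⟩ := gcd_dvd_height F.bot t
  refine ⟨k, ?_⟩
  rw [← hk, ht]
  refine le_cube_iff.2 ⟨fun s => ?_, F.bot.floor_le⟩
  have := (forall_thin_iff F).1 h s t
  linarith

theorem thin_of_le_cube {F : GridFlip m n} {c : ℤ} (h : F ≤ cube m n c) (p : GridPath m n)
    (hp : F.Member p) : p.Thin := by
  rw [le_cube_iff] at h
  refine (forall_thin_iff F).2 (fun s t => ?_) p hp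
  linarith [h.1 s, h.2 t]

theorem eq_of_cube_le_cube {c c' : ℤ} (hc : (Nat.gcd m n : ℤ) ∣ c)
    (h : cube m n c ≤ cube m n c') : c = c' := by
  obtain ⟨t, ht⟩ := exists_dvd_add_mul hc
  rw [le_cube_iff] at h
  have h1 := h.1 t
  have h2 := h.2 t
  rw [height_cube_bot_of_dvd ht] at h2
  rw [cube_top, height_stripPath_of_dvd ht] at h1
  omega

/-- Consecutive cubes share the bottom path of the one and the top path of the other. -/
theorem cube_bot_add_gcd {c : ℤ} (hc : (Nat.gcd m n : ℤ) ∣ c) :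
    (cube m n (c + Nat.gcd m n)).bot = (cube m n c).top := by
  have hd := gcd_pos (m := m) (n := n)
  have aux : ∀ z : ℤ, (Nat.gcd m n : ℤ) ∣ z → (c < z ↔ c + Nat.gcd m n ≤ z) := by
    rintro z hz
    obtain ⟨j, hj⟩ := dvd_sub hz hc
    obtain rfl : z = c + Nat.gcd m n * j := by linarith
    constructor
    · intro h
      have : 0 < j := pos_of_mul_pos_right (a := (Nat.gcd m n : ℤ)) (by omega) hd.le
      have := mul_le_mul_of_nonneg_left (show 1 ≤ j by omega) hd.le
      omega
    · intro h
      omega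
  refine eq_of_height_mem_Ioc (c := c) (fun t => ⟨?_, ?_⟩)
    fun t => ⟨lt_height_stripPath c t, height_stripPath_le c t⟩
  · rw [aux _ (gcd_dvd_height _ t)]
    exact le_height_cube_bot _ t
  · have h1 := height_cube_bot_lt (m := m) (n := n) (c + Nat.gcd m n) t
    by_contra hlt
    have h2 : c < (cube m n (c + Nat.gcd m n)).bot.height t - (m + n) := by linarith
    rw [aux _ (dvd_sub (gcd_dvd_height _ t) ?_)] at h2
    · linarith
    · have e1 : (Nat.gcd m n : ℤ) ∣ m := by exact_mod_cast Nat.gcd_dvd_left m n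
      have e2 : (Nat.gcd m n : ℤ) ∣ n := by exact_mod_cast Nat.gcd_dvd_right m n
      exact dvd_add e1 e2

/-- Two different cubes meet only if they are consecutive, and then in a single vertex: some
vertex of a path has height `c + d` modulo `m + n`, and between `c'` and `c + m + n` there is
room for such a height only if `c' ≤ c + d`. -/
theorem eq_single_of_le_cube_of_le_cube {F : GridFlip m n} {i j : ℤ} (hij : i < j)
    (hi : F ≤ cube m n (Nat.gcd m n * i)) (hj : F ≤ cube m n (Nat.gcd m n * j)) :
    j = i + 1 ∧ F = single (cube m n (Nat.gcd m n * j)).bot := by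
  have hd := gcd_pos (m := m) (n := n)
  have hN : (0 : ℤ) < m + n := GridPath.size_pos
  rw [le_cube_iff] at hi hj
  have hbt : ∀ t, F.bot.height t ≤ F.top.height t := fun t => by
    have := mul_le_mul_of_nonneg_left (F.bot_le t) hN.le
    simp only [GridPath.height]
    linarith
  have h1 := mul_le_mul_of_nonneg_left (show i + 1 ≤ j by omega) hd.le
  have hji : j = i + 1 := by
    obtain ⟨t, x, hx⟩ := exists_dvd_add_mul (m := m) (n := n)
      (c := Nat.gcd m n * (i + 1)) (Dvd.intro _ rfl)
    have h2 : F.top.height t = Nat.gcd m n * (i + 1) + (m + n) * (F.top.y t - x) := by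
      simp only [GridPath.height]
      linear_combination -hx
    have h3 := hi.1 t
    have h4 := (hj.2 t).trans (hbt t)
    rw [h2] at h3 h4
    have h5 : F.top.y t - x ≤ 0 := le_of_mul_lt_mul_add hN (by linarith)
    have h6 : (m + n : ℤ) * (F.top.y t - x) ≤ 0 := mul_nonpos_of_nonneg_of_nonpos hN.le h5
    have h7 : j ≤ i + 1 := le_of_mul_le_mul_left (by linarith) hd
    omega
  refine ⟨hji, ?_⟩
  subst hji
  have hbot : (cube m n (Nat.gcd m n * (i + 1))).bot = (cube m n (Nat.gcd m n * i)).top := by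
    rw [← cube_bot_add_gcd (Dvd.intro _ rfl), mul_add, mul_one]
  have h8 : F.top = stripPath m n (Nat.gcd m n * i) :=
    eq_of_height_mem_Ioc (fun t => ⟨by linarith [hj.2 t, hbt t], hi.1 t⟩)
      fun t => ⟨lt_height_stripPath _ t, height_stripPath_le _ t⟩
  have h9 : F.bot = stripPath m n (Nat.gcd m n * i) :=
    eq_of_height_mem_Ioc (fun t => ⟨by linarith [hj.2 t], (hbt t).trans (hi.1 t)⟩)
      fun t => ⟨lt_height_stripPath _ t, height_stripPath_le _ t⟩
  rw [hbot, cube_top]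
  ext t
  · rw [h8]; rfl
  · rw [h9]; rfl

end GridFlip

namespace IsBandCover

open GridFlip

variable {m n : ℕ} {ι C : Type*} [PartialOrder C] {b : ℕ} {π : ι → GridFlip m n → C}
  [NeZero m] [NeZero n]

theorem shift_cube_gcd {ℓ : ℕ} (hℓ : ℓ * Nat.gcd m n = b * (m + n)) (i k : ℤ) :
    (cube m n (Nat.gcd m n * i)).shift (k * b) = cube m n (Nat.gcd m n * (i + k * ℓ)) := by
  have hℓ' : (ℓ : ℤ) * Nat.gcd m n = b * (m + n) := by exact_mod_cast hℓ
  rw [cube_shift]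
  congr 1
  linear_combination -k * hℓ'

theorem exists_shift_cube_gcd {ℓ : ℕ} (hℓ : ℓ * Nat.gcd m n = b * (m + n)) {i j : ℤ}
    (h : (i : ZMod ℓ) = j) : ∃ k : ℤ, (cube m n (Nat.gcd m n * i)).shift (k * b) =
      cube m n (Nat.gcd m n * j) := by
  obtain ⟨k, hk⟩ := (ZMod.intCast_eq_intCast_iff_dvd_sub _ _ _).1 h
  refine ⟨k, ?_⟩
  rw [shift_cube_gcd hℓ]
  congr 2
  linarith

/-- The cubes that are different in the complex meet only if they are consecutive. -/
theorem inter_cubes (hπ : IsBandCover b π) {ℓ : ℕ} (hℓ : ℓ * Nat.gcd m n = b * (m + n))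
    {a a' a'' : ι} {F : GridFlip m n} {i j : ℤ} (hi : π a F ≤ π a' (cube m n (Nat.gcd m n * i)))
    (hj : π a F ≤ π a'' (cube m n (Nat.gcd m n * j))) :
    (i : ZMod ℓ) = j ∨
      (j : ZMod ℓ) = i + 1 ∧ π a F = π a (single (cube m n (Nat.gcd m n * j)).bot) ∨
      (i : ZMod ℓ) = j + 1 ∧ π a F = π a (single (cube m n (Nat.gcd m n * i)).bot) := by
  have key : ∀ i : ℤ, ∀ a', π a F ≤ π a' (cube m n (Nat.gcd m n * i)) →
      ∃ i' : ℤ, (i' : ZMod ℓ) = i ∧ F ≤ cube m n (Nat.gcd m n * i') := by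
    intro i a' hi
    obtain ⟨-, k, hk⟩ := (hπ.le_iff _ _ _ _).1 hi
    refine ⟨i + -k * ℓ, by simp, ?_⟩
    rw [← shift_cube_gcd hℓ]
    have := shift_le_shift hk (-k * b)
    rwa [shift_shift, neg_mul, add_neg_cancel, shift_zero, ← neg_mul] at this
  have key' : ∀ i i' : ℤ, (i' : ZMod ℓ) = i → π a (single (cube m n (Nat.gcd m n * i')).bot) =
      π a (single (cube m n (Nat.gcd m n * i)).bot) := by
    intro i i' h
    obtain ⟨k, hk⟩ := exists_shift_cube_gcd hℓ h
    rw [← hk, ← hπ.shift_eq a (single (cube m n (Nat.gcd m n * i')).bot) k]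
    rfl
  obtain ⟨i', hi1, hi2⟩ := key i a' hi
  obtain ⟨j', hj1, hj2⟩ := key j a'' hj
  rcases lt_trichotomy i' j' with h | h | h
  · right; left
    obtain ⟨e, hF⟩ := eq_single_of_le_cube_of_le_cube h hi2 hj2
    refine ⟨by rw [← hj1, ← hi1, e]; push_cast; rfl, ?_⟩
    rw [← key' j j' hj1, ← hF]
  · left
    rw [← hi1, ← hj1, h]
  · right; right
    obtain ⟨e, hF⟩ := eq_single_of_le_cube_of_le_cube h hj2 hi2
    refine ⟨by rw [← hj1, ← hi1, e]; push_cast; rfl, ?_⟩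
    rw [← key' i i' hi1, ← hF]

theorem intCast_eq_of_cube_eq (hπ : IsBandCover b π) {ℓ : ℕ}
    (hℓ : ℓ * Nat.gcd m n = b * (m + n)) {a a' : ι} {i j : ℤ}
    (h : π a (cube m n (Nat.gcd m n * i)) = π a' (cube m n (Nat.gcd m n * j))) :
    (i : ZMod ℓ) = j := by
  obtain ⟨-, k, hk⟩ := hπ.eq_iff.1 h
  rw [shift_cube_gcd hℓ] at hk
  have h1 : (Nat.gcd m n : ℤ) * (i + k * ℓ) = Nat.gcd m n * j :=
    eq_of_cube_le_cube (Dvd.intro _ rfl) (by rw [hk]; exact fun _ h => h)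
  rw [← mul_left_cancel₀ gcd_pos.ne' h1]
  simp

end IsBandCover

/-! ### Lifts of maps between cycles -/

section Cycles

variable {n : ℕ}

theorem cast_val_injective : Function.Injective fun x : Fin n => ((x : ℕ) : ZMod n) := by
  intro x y h
  have := (ZMod.natCast_eq_natCast_iff' _ _ _).1 h
  rw [Nat.mod_eq_of_lt x.2, Nat.mod_eq_of_lt y.2] at this
  exact Fin.ext this

theorem cycleGraph_adj_iff (hn : 2 ≤ n) {u v : Fin n} : (SimpleGraph.cycleGraph n).Adj u v ↔
    ((u : ℕ) : ZMod n) = ((v : ℕ) : ZMod n) + 1 ∨ ((v : ℕ) : ZMod n) = ((u : ℕ) : ZMod n) + 1 := by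
  have key : ∀ u v : Fin n, (u - v).val = 1 ↔
      ((u : ℕ) : ZMod n) = ((v : ℕ) : ZMod n) + 1 := by
    intro u v
    rw [Fin.val_sub]
    have h1 : (n - v.val + u.val) % n = 1 ↔ (n - v.val + u.val) % n = 1 % n := by
      rw [Nat.mod_eq_of_lt (show 1 < n by omega)]
    rw [h1, ← ZMod.natCast_eq_natCast_iff', Nat.cast_add, Nat.cast_sub v.2.le, ZMod.natCast_self,
      Nat.cast_one]
    constructor <;> intro h <;> linear_combination h
  rw [SimpleGraph.cycleGraph_adj', key, key]

theorem intCast_two_mul_eq_zero (hn : 3 ≤ n) {x : ℤ} (h : ((2 * x : ℤ) : ZMod n) = 0)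
    (h1 : -1 ≤ x) (h2 : x ≤ 1) : x = 0 := by
  rw [ZMod.intCast_zmod_eq_zero_iff_dvd] at h
  by_contra hx
  rcases (show x = 1 ∨ x = -1 by omega) with rfl | rfl
  · have := Int.le_of_dvd (by norm_num) h
    omega
  · have := Int.le_of_dvd (by norm_num) ((dvd_neg (α := ℤ)).2 h)
    omega

/-- In a cycle of length different from `4`, two distinct vertices have at most one common
neighbour. -/
theorem eq_of_common_neighbours (hn : 3 ≤ n) (hn4 : n ≠ 4) {x x' y y' : Fin n} (hx : x ≠ x')
    (h1 : (SimpleGraph.cycleGraph n).Adj x y) (h2 : (SimpleGraph.cycleGraph n).Adj x' y)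
    (h3 : (SimpleGraph.cycleGraph n).Adj x y') (h4 : (SimpleGraph.cycleGraph n).Adj x' y') :
    y = y' := by
  have hn2 : 2 ≤ n := by omega
  rw [cycleGraph_adj_iff hn2] at h1 h2 h3 h4
  have hx' : ((x : ℕ) : ZMod n) ≠ ((x' : ℕ) : ZMod n) := fun h => hx (cast_val_injective h)
  have h4' : (4 : ZMod n) ≠ 0 := by
    intro h
    have h5 : n ∣ 4 := (ZMod.natCast_eq_zero_iff 4 n).1 (by exact_mod_cast h)
    have h6 := Nat.le_of_dvd (by norm_num) h5
    interval_cases n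
    · omega
    · omega
  apply cast_val_injective
  dsimp only
  generalize ((x : ℕ) : ZMod n) = x, ((x' : ℕ) : ZMod n) = x', ((y : ℕ) : ZMod n) = y,
    ((y' : ℕ) : ZMod n) = y' at *
  rcases h1 with h1 | h1 <;> rcases h2 with h2 | h2 <;> rcases h3 with h3 | h3 <;>
    rcases h4 with h4 | h4 <;> first
    | exact absurd (by linear_combination h1 - h2) hx'
    | exact absurd (by linear_combination h2 - h1) hx'
    | linear_combination h3 - h1
    | linear_combination h1 - h3
    | exact absurd (by linear_combination h3 - h4) hx'
    | exact absurd (by linear_combination h4 - h3) hx'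
    | exact absurd (by linear_combination -(h1 + h2 + h3 + h4)) h4'

variable [NeZero n]

/-- The residue class of an integer as a vertex of the `n`-cycle. -/
def residue (n : ℕ) [NeZero n] (z : ℤ) : Fin n :=
  ⟨(z % n).toNat, by
    have h : (0 : ℤ) < n := by exact_mod_cast NeZero.pos n
    have := Int.emod_lt_of_pos z h
    have := Int.emod_nonneg z h.ne'
    omega⟩

theorem val_residue (z : ℤ) : ((residue n z : ℕ) : ℤ) = z % n :=
  Int.toNat_of_nonneg (Int.emod_nonneg z (by exact_mod_cast NeZero.ne n))

theorem cast_residue (z : ℤ) : ((residue n z : ℕ) : ZMod n) = z := by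
  rw [← Int.cast_natCast, val_residue, ZMod.intCast_mod]

theorem residue_eq_iff {z : ℤ} {x : Fin n} : residue n z = x ↔ (z : ZMod n) = ((x : ℕ) : ZMod n) := by
  rw [← cast_residue]
  exact cast_val_injective.eq_iff.symm

theorem residue_eq_residue {z z' : ℤ} : residue n z = residue n z' ↔ (z : ZMod n) = z' := by
  rw [residue_eq_iff, cast_residue]

@[simp] theorem residue_val (x : Fin n) : residue n (x : ℕ) = x := by
  rw [residue_eq_iff, Int.cast_natCast]

theorem cycleGraph_adj_residue (hn : 2 ≤ n) {z z' : ℤ} (h : z' = z + 1 ∨ z' = z - 1) :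
    (SimpleGraph.cycleGraph n).Adj (residue n z) (residue n z') := by
  rw [cycleGraph_adj_iff hn, cast_residue, cast_residue]
  rcases h with rfl | rfl
  · right; push_cast; ring
  · left; push_cast; ring

theorem exists_of_cycleGraph_adj (hn : 2 ≤ n) {x y : Fin n}
    (h : (SimpleGraph.cycleGraph n).Adj x y) :
    ∃ t : ℤ, x = residue n t ∧ y = residue n (t + 1) ∨
      y = residue n t ∧ x = residue n (t + 1) := by
  rw [cycleGraph_adj_iff hn] at h
  rcases h with h | h
  · exact ⟨(y : ℕ), Or.inr ⟨by simp, (residue_eq_iff.2 (by push_cast; exact h.symm)).symm⟩⟩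
  · exact ⟨(x : ℕ), Or.inl ⟨by simp, (residue_eq_iff.2 (by push_cast; exact h.symm)).symm⟩⟩

variable {m : ℕ} [NeZero m] {f : SimpleGraph.cycleGraph m →g SimpleGraph.cycleGraph n}
  {z z' : ℤ → ℤ}

theorem isCycleLift_iff : IsCycleLift f z ↔ (∀ t, z (t + 1) = z t + 1 ∨ z (t + 1) = z t - 1) ∧
    ∀ t, f (residue m t) = residue n (z t) := by
  refine and_congr_right fun _ => ?_
  simp only [← ZMod.intCast_eq_intCast_iff]
  constructor
  · intro h t
    have := h t (residue m t) (by rw [Int.cast_natCast, cast_residue])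
    rw [Int.cast_natCast] at this
    exact (residue_eq_iff.2 this).symm
  · intro h t i hti
    rw [Int.cast_natCast] at hti ⊢
    rw [← residue_eq_iff] at hti ⊢
    rw [← h t, hti]

theorem IsCycleLift.exists_eq_add (hn : 3 ≤ n) (hz : IsCycleLift f z) (hz' : IsCycleLift f z') :
    ∃ j : ℤ, ∀ t, z' t = z t + n * j := by
  rw [isCycleLift_iff] at hz hz'
  have hD : ∀ t, ((z' t - z t : ℤ) : ZMod n) = 0 := fun t => by
    rw [Int.cast_sub, sub_eq_zero, ← residue_eq_residue, ← hz.2, ← hz'.2]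
  have hstep : ∀ t, z' (t + 1) - z (t + 1) = z' t - z t := by
    intro t
    have h1 := hz.1 t
    have h2 := hz'.1 t
    obtain ⟨x, hx⟩ : ∃ x, z' (t + 1) - z (t + 1) - (z' t - z t) = 2 * x :=
      ⟨(z' (t + 1) - z (t + 1) - (z' t - z t)) / 2, by omega⟩
    have := intCast_two_mul_eq_zero hn (x := x)
      (by rw [← hx, Int.cast_sub, hD, hD, sub_zero]) (by omega) (by omega)
    omega
  have hconst : ∀ t, z' t - z t = z' 0 - z 0 := by
    intro t
    induction t using Int.induction_on with
    | zero => rfl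
    | succ i ih => rw [hstep, ih]
    | pred i ih => rw [← ih, ← hstep, sub_add_cancel]
  obtain ⟨j, hj⟩ := (ZMod.intCast_zmod_eq_zero_iff_dvd _ _).1 (hD 0)
  exact ⟨j, fun t => by rw [← hj, ← hconst t]; ring⟩

end Cycles

/-! ### Cells of the winding complex as flips -/

/-- The numerical data of the homomorphisms from the `M`-cycle to the `n`-cycle with winding number
`w`: they make `k` backward steps and `l` forward steps. -/
structure WindingData (M n w k l : ℕ) : Prop where
  length_eq : M = k + l
  forward_eq : l = n * w + k
  two_le : 2 ≤ M
  three_le : 3 ≤ n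
  ne_four : n ≠ 4

theorem HomCell.exists_hasVertex {V W : Type*} {T : SimpleGraph V} {G : SimpleGraph W}
    (σ : HomCell T G) : ∃ f, σ.HasVertex f := by
  choose f hf using σ.nonempty
  exact ⟨⟨f, fun {x y} h => σ.adj x y h _ (hf x) _ (hf y)⟩, hf⟩

/-- For lifts to the universal cover of the `n`-cycle, the winding complex is a disjoint union of
`s` complexes of `b`-band flips: a single one with `b = n` if `n` is odd, and two with `b = n / 2`,
distinguished by the parity of the lifts, if `n` is even. -/
structure BandNumber (n s b : ℕ) : Prop where
  mul_eq : s * b = n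
  cases : s = 1 ∧ Odd n ∨ s = 2

theorem bandNumber (n : ℕ) :
    BandNumber n (if Even n then 2 else 1) (if Even n then n / 2 else n) := by
  by_cases h : Even n
  · rw [if_pos h, if_pos h]
    exact ⟨Nat.two_mul_div_two_of_even h, Or.inr rfl⟩
  · rw [if_neg h, if_neg h]
    exact ⟨one_mul n, Or.inl ⟨rfl, Nat.not_even_iff_odd.1 h⟩⟩

namespace BandNumber

variable {n s b : ℕ}

theorem dvd (B : BandNumber n s b) : (n : ℤ) ∣ 2 * b := by
  obtain ⟨h, ⟨rfl, -⟩ | rfl⟩ := B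
  · rw [one_mul] at h
    rw [h]
    exact Dvd.intro_left _ rfl
  · rw [← h]
    push_cast
    exact dvd_rfl

theorem exists_eq_add (B : BandNumber n s b) {a a' : Fin s} {u u' j : ℤ}
    (h : ((a' : ℕ) : ℤ) + 2 * u' = (a : ℕ) + 2 * u + n * j) : a = a' ∧ ∃ e, u' = u + e * b := by
  obtain ⟨hn, ⟨rfl, hodd⟩ | rfl⟩ := B
  · rw [one_mul] at hn
    subst hn
    have ha : a = a' := Subsingleton.elim _ _
    refine ⟨ha, ?_⟩
    subst ha
    have h1 : Even ((b : ℤ) * j) := ⟨u' - u, by linarith⟩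
    rw [Int.even_mul] at h1
    obtain ⟨e, rfl⟩ := h1.resolve_left (by
      rw [Int.not_even_iff_odd]; exact_mod_cast hodd)
    exact ⟨e, by linarith⟩
  · have h1 : ((a' : ℕ) : ℤ) + 2 * u' = (a : ℕ) + 2 * u + 2 * (b * j) := by
      rw [h, ← hn]; push_cast; ring
    have := a.2
    have := a'.2
    exact ⟨Fin.ext (by omega), j, by rw [mul_comm j]; omega⟩

theorem exists_index (B : BandNumber n s b) (q : ℤ) :
    ∃ (a : Fin s) (c j : ℤ), q = (a : ℕ) + 2 * c + n * j := by
  obtain ⟨hn, ⟨rfl, hodd⟩ | rfl⟩ := B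
  · rcases Int.even_or_odd' q with ⟨c, rfl | rfl⟩
    · exact ⟨0, c, 0, by simp⟩
    · obtain ⟨i, rfl⟩ := hodd
      exact ⟨0, c - i, 1, by push_cast; simp; ring⟩
  · exact ⟨⟨(q % 2).toNat, by omega⟩, q / 2, 0, by push_cast; omega⟩

end BandNumber

/-- The vertex of the `n`-cycle corresponding to the vertex `(t - u, u)` of a grid path, if paths
start at height `q` in the universal cover of the `n`-cycle. -/
def site (n : ℕ) [NeZero n] (q t u : ℤ) : Fin n := residue n (q + 2 * u - t)

namespace WindingData

open GridFlip SimpleGraph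

variable {M n w k l : ℕ}

theorem y_add_mul (P : WindingData M n w k l) (p : GridPath k l) (t j : ℤ) :
    p.y (t + M * j) = p.y t + l * j := by
  have h1 : (M : ℤ) = k + l := by exact_mod_cast P.length_eq
  rw [h1, p.y_add_mul]

theorem residue_add_size [NeZero M] (P : WindingData M n w k l) (t : ℤ) :
    residue M (t + (k + l)) = residue M t := by
  have h1 : (M : ℤ) = k + l := by exact_mod_cast P.length_eq
  rw [residue_eq_residue, ← h1]
  simp

variable [NeZero n]

theorem site_eq_site {q q' t u u' : ℤ} :
    site n q t u = site n q' t u' ↔ ((q + 2 * u : ℤ) : ZMod n) = ((q' + 2 * u' : ℤ) : ZMod n) := by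
  rw [site, site, residue_eq_residue, Int.cast_sub, Int.cast_sub, sub_left_inj]

theorem site_add (P : WindingData M n w k l) (q t u j : ℤ) :
    site n q (t + M * j) (u + l * j) = site n q t u := by
  have h1 : (M : ℤ) = k + l := by exact_mod_cast P.length_eq
  have h2 : (l : ℤ) = n * w + k := by exact_mod_cast P.forward_eq
  rw [site, site, residue_eq_residue, ← sub_eq_zero, ← Int.cast_sub,
    ZMod.intCast_zmod_eq_zero_iff_dvd]
  exact ⟨w * j, by rw [h1]; linear_combination j * h2⟩

theorem site_injective (hn : 3 ≤ n) {q t u u' : ℤ} (h : site n q t u = site n q t u')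
    (h1 : u ≤ u' + 1) (h2 : u' ≤ u + 1) : u = u' := by
  rw [site_eq_site, ← sub_eq_zero, ← Int.cast_sub] at h
  have := intCast_two_mul_eq_zero hn (x := u - u') (by rw [← h]; congr 1; ring) (by omega)
    (by omega)
  omega

theorem site_adj (hn : 3 ≤ n) {q t u v : ℤ} (h : v = u ∨ v = u + 1) :
    (cycleGraph n).Adj (site n q t u) (site n q (t + 1) v) :=
  cycleGraph_adj_residue (by omega) (by omega)

variable [NeZero M]

theorem exists_val_residue (t : ℤ) : ∃ j : ℤ, t = ((residue M t : ℕ) : ℤ) + M * j :=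
  ⟨t / M, by rw [val_residue, Int.emod_add_mul_ediv]⟩

theorem site_val_residue (P : WindingData M n w k l) (p : GridPath k l) (q t : ℤ) :
    site n q ((residue M t : ℕ) : ℤ) (p.y ((residue M t : ℕ) : ℤ)) = site n q t (p.y t) := by
  obtain ⟨j, hj⟩ := exists_val_residue (M := M) t
  conv_rhs => rw [hj, P.y_add_mul, P.site_add]

/-- The homomorphism encoded by a grid path. -/
def hom (P : WindingData M n w k l) (q : ℤ) (p : GridPath k l) :
    cycleGraph M →g cycleGraph n where
  toFun i := site n q (i : ℕ) (p.y (i : ℕ))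
  map_rel' := by
    intro x y hxy
    obtain ⟨t, ⟨rfl, rfl⟩ | ⟨rfl, rfl⟩⟩ := exists_of_cycleGraph_adj P.two_le hxy
    · rw [P.site_val_residue, P.site_val_residue]
      exact site_adj P.three_le (p.step t)
    · rw [P.site_val_residue, P.site_val_residue]
      exact (site_adj P.three_le (p.step t)).symm

theorem hom_apply (P : WindingData M n w k l) (q : ℤ) (p : GridPath k l) (i : Fin M) :
    P.hom q p i = site n q (i : ℕ) (p.y (i : ℕ)) := rfl

theorem hom_residue (P : WindingData M n w k l) (q : ℤ) (p : GridPath k l) (t : ℤ) :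
    P.hom q p (residue M t) = site n q t (p.y t) := P.site_val_residue p q t

theorem isCycleLift_hom (P : WindingData M n w k l) (q : ℤ) (p : GridPath k l) :
    IsCycleLift (P.hom q p) fun t => q + 2 * p.y t - t := by
  refine isCycleLift_iff.2 ⟨fun t => ?_, P.hom_residue q p⟩
  have := p.step t
  omega

theorem hasWindingNumber_hom (P : WindingData M n w k l) (q : ℤ) (p : GridPath k l) :
    HasWindingNumber (P.hom q p) w := by
  have h1 : (M : ℤ) = k + l := by exact_mod_cast P.length_eq
  have h2 : (l : ℤ) = n * w + k := by exact_mod_cast P.forward_eq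
  refine ⟨_, P.isCycleLift_hom q p, fun t => ?_⟩
  rw [h1, p.periodic]
  linear_combination h2

theorem encodes_iff (P : WindingData M n w k l) {p : GridPath k l}
    {f : cycleGraph M →g cycleGraph n} : p.Encodes f ↔ ∃ q, f = P.hom q p := by
  constructor
  · rintro ⟨q, hq⟩
    refine ⟨q, DFunLike.ext _ _ fun i => ?_⟩
    rw [← residue_val i, P.hom_residue, (isCycleLift_iff.1 hq).2]
    rfl
  · rintro ⟨q, rfl⟩
    exact ⟨q, P.isCycleLift_hom q p⟩

theorem exists_eq_hom (P : WindingData M n w k l) {f : cycleGraph M →g cycleGraph n}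
    (hf : HasWindingNumber f w) : ∃ q p, f = P.hom q p := by
  have h1 : (M : ℤ) = k + l := by exact_mod_cast P.length_eq
  have h2 : (l : ℤ) = n * w + k := by exact_mod_cast P.forward_eq
  obtain ⟨z, hz, hper⟩ := hf
  have hz' := isCycleLift_iff.1 hz
  have hpar : ∀ t, (z t - z 0 + t) % 2 = 0 := by
    intro t
    induction t using Int.induction_on with
    | zero => simp
    | succ i ih => have := hz'.1 i; omega
    | pred i ih => have := hz'.1 (-i - 1); rw [sub_add_cancel] at this; omega
  let p : GridPath k l :=
    { y := fun t => (z t - z 0 + t) / 2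
      step := fun t => by
        have := hz'.1 t
        have := hpar t
        have := hpar (t + 1)
        omega
      periodic := fun t => by
        have e1 := hper t
        have e2 := hpar t
        have e3 := hpar (t + M)
        rw [← h1]
        omega }
  refine ⟨z 0, p, DFunLike.ext _ _ fun i => ?_⟩
  rw [← residue_val i, P.hom_residue, hz'.2]
  have e : p.y ((i : ℕ) : ℤ) = (z (i : ℕ) - z 0 + (i : ℕ)) / 2 := rfl
  rw [site, e]
  congr 1
  have := hpar (i : ℕ)
  omega

/-- The cell of the complex of homomorphisms given by a flip of grid paths. -/
def cell (P : WindingData M n w k l) (q : ℤ) (F : GridFlip k l) :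
    HomCell (cycleGraph M) (cycleGraph n) where
  toFun i := {P.hom q F.bot i, P.hom q F.top i}
  nonempty i := Finset.insert_nonempty _ _
  adj := by
    have key : ∀ t : ℤ, ∀ a ∈ ({P.hom q F.bot (residue M t), P.hom q F.top (residue M t)} : Finset _),
        ∀ b ∈ ({P.hom q F.bot (residue M (t + 1)), P.hom q F.top (residue M (t + 1))} : Finset _),
        (cycleGraph n).Adj a b := by
      intro t a ha b hb
      simp only [Finset.mem_insert, Finset.mem_singleton, hom_residue] at ha hb
      obtain ⟨u, hu, rfl⟩ : ∃ u, (u = F.top.y t ∨ u = F.bot.y t) ∧ a = site n q t u := by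
        rcases ha with rfl | rfl
        · exact ⟨_, Or.inr rfl, rfl⟩
        · exact ⟨_, Or.inl rfl, rfl⟩
      obtain ⟨v, hv, rfl⟩ : ∃ v, (v = F.top.y (t + 1) ∨ v = F.bot.y (t + 1)) ∧
          b = site n q (t + 1) v := by
        rcases hb with rfl | rfl
        · exact ⟨_, Or.inr rfl, rfl⟩
        · exact ⟨_, Or.inl rfl, rfl⟩
      exact site_adj P.three_le (F.step_of_choice hu hv)
    intro x y hxy a ha b hb
    obtain ⟨t, ⟨rfl, rfl⟩ | ⟨rfl, rfl⟩⟩ := exists_of_cycleGraph_adj P.two_le hxy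
    · exact key t a ha b hb
    · exact (key t b hb a ha).symm

theorem mem_cell (P : WindingData M n w k l) {q : ℤ} {F : GridFlip k l} {i : Fin M} {x : Fin n} :
    x ∈ (P.cell q F).toFun i ↔ x = P.hom q F.bot i ∨ x = P.hom q F.top i := by
  simp [cell]

theorem mem_cell_residue (P : WindingData M n w k l) {q : ℤ} {F : GridFlip k l} {t : ℤ}
    {x : Fin n} : x ∈ (P.cell q F).toFun (residue M t) ↔
      x = site n q t (F.bot.y t) ∨ x = site n q t (F.top.y t) := by
  rw [mem_cell, hom_residue, hom_residue]

theorem site_add_size (P : WindingData M n w k l) (p : GridPath k l) (q t : ℤ) :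
    site n q (t + (k + l)) (p.y (t + (k + l))) = site n q t (p.y t) := by
  rw [← P.hom_residue, P.residue_add_size, P.hom_residue]

theorem hasVertex_cell_iff (P : WindingData M n w k l) {q : ℤ} {F : GridFlip k l}
    {f : cycleGraph M →g cycleGraph n} :
    (P.cell q F).HasVertex f ↔ ∃ p, F.Member p ∧ f = P.hom q p := by
  constructor
  · intro h
    let S : Set ℤ := {t | f (residue M t) = site n q t (F.top.y t)}
    have hS : ∀ t : ℤ, t + (k + l) ∈ S ↔ t ∈ S := fun t => by
      simp only [S, Set.mem_ofPred_eq, P.residue_add_size, P.site_add_size]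
    refine ⟨F.select S hS, F.member_select S hS, DFunLike.ext _ _ fun i => ?_⟩
    rw [← residue_val i, P.hom_residue]
    by_cases hi : ((i : ℕ) : ℤ) ∈ S
    · rw [select_of_mem hi]; exact hi
    · rw [select_of_notMem hi]
      exact (P.mem_cell_residue.1 (h _)).resolve_right hi
  · rintro ⟨p, hp, rfl⟩ i
    rw [← residue_val i, mem_cell_residue, hom_residue]
    rcases hp (i : ℕ) with e | e
    · exact Or.inr (by rw [e])
    · exact Or.inl (by rw [e])

theorem hasVertex_hom_top (P : WindingData M n w k l) (q : ℤ) (F : GridFlip k l) :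
    (P.cell q F).HasVertex (P.hom q F.top) :=
  P.hasVertex_cell_iff.2 ⟨_, F.member_top, rfl⟩

theorem hasVertex_hom_bot (P : WindingData M n w k l) (q : ℤ) (F : GridFlip k l) :
    (P.cell q F).HasVertex (P.hom q F.bot) :=
  P.hasVertex_cell_iff.2 ⟨_, F.member_bot, rfl⟩

theorem cell_mem_windingComplex (P : WindingData M n w k l) (q : ℤ) (F : GridFlip k l) :
    P.cell q F ∈ windingComplex M n w := by
  intro f hf
  obtain ⟨p, -, rfl⟩ := P.hasVertex_cell_iff.1 hf
  exact P.hasWindingNumber_hom q p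

theorem cell_single (P : WindingData M n w k l) (q : ℤ) (p : GridPath k l) :
    P.cell q (single p) = HomCell.vertex (P.hom q p) := by
  ext i x
  rw [mem_cell]
  simp [single, HomCell.vertex]

/-- A cell with at least two choices at a vertex of `C_M` allows only one choice at the two
neighbours, where it takes the same value. Hence it arises from a flip. -/
theorem exists_eq_cell (P : WindingData M n w k l) {σ : HomCell (cycleGraph M) (cycleGraph n)}
    (hσ : σ ∈ windingComplex M n w) : ∃ q F, σ = P.cell q F := by
  obtain ⟨f, hf⟩ := σ.exists_hasVertex
  obtain ⟨q, p, rfl⟩ := P.exists_eq_hom (hσ f hf)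
  have hmem : ∀ t, site n q t (p.y t) ∈ σ.toFun (residue M t) := fun t => by
    rw [← P.hom_residue]; exact hf _
  have hadj : ∀ t : ℤ, ∀ a ∈ σ.toFun (residue M t), ∀ b ∈ σ.toFun (residue M (t + 1)),
      (cycleGraph n).Adj a b := fun t =>
    σ.adj _ _ (cycleGraph_adj_residue P.two_le (Or.inl rfl))
  have hadj' : ∀ t : ℤ, ∀ a ∈ σ.toFun (residue M t), ∀ b ∈ σ.toFun (residue M (t - 1)),
      (cycleGraph n).Adj a b := fun t a ha b hb =>
    (hadj (t - 1) b hb a (by rwa [sub_add_cancel])).symm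
  let S : Set ℤ := {t | ∃ b ∈ σ.toFun (residue M t), b ≠ site n q t (p.y t)}
  have hS : ∀ t : ℤ, t + (k + l) ∈ S ↔ t ∈ S := fun t => by
    simp only [S, Set.mem_ofPred_eq, P.residue_add_size, P.site_add_size]
  have hnext : ∀ t ∈ S, t + 1 ∉ S := by
    rintro t ⟨b, hb, hne⟩ ⟨c, hc, hne'⟩
    exact hne' (eq_of_common_neighbours P.three_le P.ne_four hne (hadj t b hb c hc)
      (hadj t _ (hmem t) c hc) (hadj t b hb _ (hmem _)) (hadj t _ (hmem t) _ (hmem _)))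
  have hprev : ∀ t ∈ S, t - 1 ∉ S := fun t ht h =>
    hnext _ h (by rwa [sub_add_cancel])
  -- at a position with a choice the path has a corner
  have hcorner : ∀ t ∈ S, p.y (t + 1) = p.y (t - 1) + 1 := by
    rintro t ⟨b, hb, hne⟩
    have h1 : site n q (t - 1) (p.y (t - 1)) = site n q (t + 1) (p.y (t + 1)) :=
      eq_of_common_neighbours P.three_le P.ne_four hne (hadj' t b hb _ (hmem _))
        (hadj' t _ (hmem t) _ (hmem _)) (hadj t b hb _ (hmem _)) (hadj t _ (hmem t) _ (hmem _))
    have h2 := p.step (t - 1)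
    have h3 := p.step t
    rw [sub_add_cancel] at h2
    rw [site, site, residue_eq_residue, ← sub_eq_zero, ← Int.cast_sub] at h1
    have := intCast_two_mul_eq_zero P.three_le (x := p.y (t - 1) + 1 - p.y (t + 1))
      (by rw [← h1]; congr 1; ring) (by omega) (by omega)
    omega
  let S' : Set ℤ := {t | t ∈ S ∧ p.y t = p.y (t - 1)}
  have hS' : ∀ t : ℤ, t + (k + l) ∈ S' ↔ t ∈ S' := fun t => by
    have e : t + ((k : ℤ) + l) - 1 = t - 1 + (k + l) := by ring
    simp only [S', Set.mem_ofPred_eq, hS, e, p.periodic, add_left_inj]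
  classical
  let top : GridPath k l :=
    { y := fun t => if t ∈ S then p.y (t - 1) + 1 else p.y t
      step := fun t => by
        have h0 := p.step t
        by_cases h1 : t ∈ S
        · rw [if_pos h1, if_neg (hnext t h1), hcorner t h1]
          exact Or.inl rfl
        · by_cases h2 : t + 1 ∈ S
          · rw [if_neg h1, if_pos h2, add_sub_cancel_right]
            exact Or.inr rfl
          · rw [if_neg h1, if_neg h2]
            exact h0
      periodic := fun t => by
        have e : t + ((k : ℤ) + l) - 1 = t - 1 + (k + l) := by ring
        by_cases h : t ∈ S
        · rw [if_pos h, if_pos ((hS t).2 h), e, p.periodic]; ring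
        · rw [if_neg h, if_neg (mt (hS t).1 h), p.periodic] }
  have htop : ∀ t ∈ S, top.y t = p.y (t - 1) + 1 := fun t h => if_pos h
  have htop' : ∀ t, t ∉ S → top.y t = p.y t := fun t h => if_neg h
  let F : GridFlip k l := ofCorners top S hS fun t ht => by
    rw [htop t ht, htop' _ (hprev t ht), htop' _ (hnext t ht), hcorner t ht]
    exact ⟨rfl, rfl⟩
  have hbot : ∀ t ∈ S, F.bot.y t = p.y (t - 1) := fun t ht => by
    rw [ofCorners_bot_of_mem ht, htop t ht]; ring
  have hbot' : ∀ t, t ∉ S → F.bot.y t = p.y t := fun t ht => by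
    rw [ofCorners_bot_of_notMem ht, htop' t ht]
  refine ⟨q, F, HomCell.ext (funext fun i => Finset.ext fun x => ?_)⟩
  rw [← residue_val i, mem_cell_residue]
  generalize ((i : ℕ) : ℤ) = t
  rw [ofCorners_top]
  by_cases ht : t ∈ S
  · rw [htop t ht, hbot t ht]
    have hsub : ∀ y ∈ σ.toFun (residue M t),
        y = site n q t (p.y (t - 1)) ∨ y = site n q t (p.y (t - 1) + 1) := by
      intro y hy
      have h1 := hadj' t y hy _ (hmem _)
      rw [cycleGraph_adj_iff (by have := P.three_le; omega), site, cast_residue] at h1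
      rcases h1 with h1 | h1
      · right
        refine (residue_eq_iff.2 ?_).symm
        rw [h1]; push_cast; ring
      · left
        refine (residue_eq_iff.2 ?_).symm
        have h2 := eq_sub_of_add_eq h1.symm
        rw [h2]; push_cast; ring
    refine ⟨hsub x, ?_⟩
    obtain ⟨b, hb, hne⟩ := ht
    have h1 := hsub b hb
    have h2 := hsub _ (hmem t)
    generalize site n q t (p.y (t - 1)) = u, site n q t (p.y (t - 1) + 1) = v at *
    have h3 := hmem t
    generalize site n q t (p.y t) = c at *
    rintro (rfl | rfl)
    · rcases h1 with rfl | rfl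
      · exact hb
      · rcases h2 with rfl | rfl
        · exact h3
        · exact absurd rfl hne
    · rcases h1 with rfl | rfl
      · rcases h2 with rfl | rfl
        · exact absurd rfl hne
        · exact h3
      · exact hb
  · rw [htop' t ht, hbot' t ht, or_self]
    constructor
    · intro hx
      by_contra hne
      exact ht ⟨x, hx, hne⟩
    · rintro rfl
      exact hmem t

/-! ### Cells of the winding complex up to translation -/

variable {s b : ℕ}

theorem hom_shift (P : WindingData M n w k l) {q q' c j : ℤ} (h : q = q' + 2 * c + n * j)
    (p : GridPath k l) : P.hom q' (p.shift c) = P.hom q p := by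
  refine DFunLike.ext _ _ fun i => ?_
  rw [hom_apply, hom_apply, site_eq_site, h]
  simp only [GridPath.shift]
  push_cast
  rw [ZMod.natCast_self]
  ring

theorem cell_shift (P : WindingData M n w k l) {q q' c j : ℤ} (h : q = q' + 2 * c + n * j)
    (F : GridFlip k l) : P.cell q' (F.shift c) = P.cell q F := by
  have h1 : P.hom q' (F.shift c).top = P.hom q F.top := P.hom_shift h _
  have h2 : P.hom q' (F.shift c).bot = P.hom q F.bot := P.hom_shift h _
  ext i x
  rw [mem_cell, mem_cell, h1, h2]

theorem hom_shift_band (P : WindingData M n w k l) (B : BandNumber n s b) (q e : ℤ)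
    (p : GridPath k l) : P.hom q (p.shift (e * b)) = P.hom q p := by
  obtain ⟨j, hj⟩ := B.dvd
  exact P.hom_shift (j := -(j * e)) (by linear_combination (-e) * hj) p

theorem exists_eq_of_hom_eq (P : WindingData M n w k l) {q q' : ℤ} {p p' : GridPath k l}
    (h : P.hom q p = P.hom q' p') : ∃ j : ℤ, ∀ t, q + 2 * p.y t = q' + 2 * p'.y t + n * j := by
  have h1 := P.isCycleLift_hom q p
  rw [h] at h1
  obtain ⟨j, hj⟩ := (P.isCycleLift_hom q' p').exists_eq_add P.three_le h1
  exact ⟨j, fun t => by linarith [hj t]⟩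

theorem exists_shift_of_hom_eq (P : WindingData M n w k l) (B : BandNumber n s b) {a a' : Fin s}
    {p p' : GridPath k l} (h : P.hom (a : ℕ) p = P.hom (a' : ℕ) p') :
    a = a' ∧ ∃ e : ℤ, p = p'.shift (e * b) := by
  obtain ⟨j, hj⟩ := P.exists_eq_of_hom_eq h
  obtain ⟨rfl, e, he⟩ := B.exists_eq_add (hj 0)
  refine ⟨rfl, e, GridPath.ext (funext fun t => ?_)⟩
  have h1 := hj t
  have h2 := hj 0
  simp only [GridPath.shift]
  linarith

theorem thin_of_encodes [NeZero k] (P : WindingData M n w k l) {q : ℤ} {p p' : GridPath k l}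
    (h : p'.Encodes (P.hom q p)) (hp' : p'.Thin) : p.Thin := by
  obtain ⟨q', hq'⟩ := P.encodes_iff.1 h
  obtain ⟨j, hj⟩ := P.exists_eq_of_hom_eq hq'
  have : p = p'.shift (p.y 0 - p'.y 0) := GridPath.ext (funext fun t => by
    have h1 := hj t
    have h2 := hj 0
    simp only [GridPath.shift]
    linarith)
  rw [this, GridPath.thin_shift]
  exact hp'

/-- The flips of grid paths cover the winding complex; if `n` is even, the index is the parity of the
starting point of the lift. -/
theorem isBandCover (P : WindingData M n w k l) (B : BandNumber n s b) :
    IsBandCover b (fun (a : Fin s) (F : GridFlip k l) => P.cell (a : ℕ) F) where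
  le_iff a a' F G := by
    have hb : 2 ≤ b := by
      have h3 := P.three_le
      have h4 := P.ne_four
      obtain ⟨hn, ⟨rfl, -⟩ | rfl⟩ := B <;> omega
    constructor
    · intro h
      have htop : (P.cell (a' : ℕ) G).HasVertex (P.hom (a : ℕ) F.top) :=
        fun i => h i (P.hasVertex_hom_top _ F i)
      have hbot : (P.cell (a' : ℕ) G).HasVertex (P.hom (a : ℕ) F.bot) :=
        fun i => h i (P.hasVertex_hom_bot _ F i)
      obtain ⟨p, hp, e1⟩ := P.hasVertex_cell_iff.1 htop
      obtain ⟨p', hp', e2⟩ := P.hasVertex_cell_iff.1 hbot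
      obtain ⟨rfl, e, he⟩ := P.exists_shift_of_hom_eq B e1
      obtain ⟨-, e', he'⟩ := P.exists_shift_of_hom_eq B e2
      refine ⟨rfl, -e, ?_⟩
      -- the two translations agree, since the top and the bottom path have a common vertex
      obtain ⟨t, ht⟩ : ∃ t, F.bot.y t = F.top.y t := by
        by_contra hall
        exact hall ⟨1, by simpa using F.apart 0 fun h0 => hall ⟨0, h0⟩⟩
      have hee : e = e' := by
        rw [he, he'] at ht
        simp only [GridPath.shift] at ht
        have h1 := hp t
        have h2 := hp' t
        have h3 := G.bot_eq t
        have h4 : (b : ℤ) * (e' - e) = p.y t - p'.y t := by linear_combination ht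
        have hb' : (0 : ℤ) < b := by omega
        have h5 : e' - e ≤ 0 := le_of_mul_lt_mul_add hb' (by rw [h4]; omega)
        have h6 : e - e' ≤ 0 := le_of_mul_lt_mul_add hb' (by
          rw [← neg_sub e' e, mul_neg, h4]; omega)
        omega
      subst hee
      refine GridFlip.le_iff.2 ⟨fun t => ?_, fun t => ?_⟩
      · have := hp.le_top t
        simp only [GridFlip.shift, he, GridPath.shift]
        linarith
      · have := hp'.bot_le t
        simp only [GridFlip.shift, he', GridPath.shift]
        linarith
    · rintro ⟨rfl, e, h⟩
      have h1 : P.cell (a : ℕ) (F.shift (e * b)) = P.cell (a : ℕ) F := by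
        obtain ⟨j, hj⟩ := B.dvd
        exact P.cell_shift (j := -(j * e)) (by linear_combination (-e) * hj) F
      rw [← h1]
      intro i x hx
      rw [mem_cell] at hx
      rcases hx with rfl | rfl
      · exact P.hasVertex_cell_iff.2 ⟨_, h _ (F.shift (e * b)).member_bot, rfl⟩ i
      · exact P.hasVertex_cell_iff.2 ⟨_, h _ (F.shift (e * b)).member_top, rfl⟩ i

theorem exists_eq_cell_index (P : WindingData M n w k l) (B : BandNumber n s b)
    {σ : HomCell (cycleGraph M) (cycleGraph n)} (hσ : σ ∈ windingComplex M n w) :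
    ∃ (a : Fin s) (F : GridFlip k l), σ = P.cell (a : ℕ) F := by
  obtain ⟨q, F, rfl⟩ := P.exists_eq_cell hσ
  obtain ⟨a, c, j, h⟩ := B.exists_index q
  exact ⟨a, F.shift c, (P.cell_shift h F).symm⟩

theorem legSet_eq (P : WindingData M n w k l) (B : BandNumber n s b) :
    IsBandCover.legSet (fun (a : Fin s) (F : GridFlip k l) => P.cell (a : ℕ) F) 0 =
      windingComplex M n w := by
  ext σ
  constructor
  · rintro ⟨a, F, rfl, -⟩
    exact P.cell_mem_windingComplex _ F
  · intro hσ
    obtain ⟨a, F, rfl⟩ := P.exists_eq_cell_index B hσ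
    exact ⟨a, F, rfl, fun p _ t _ j h1 h2 => by omega⟩

theorem thinSet_eq [NeZero k] (P : WindingData M n w k l) (B : BandNumber n s b) :
    IsBandCover.thinSet (fun (a : Fin s) (F : GridFlip k l) => P.cell (a : ℕ) F) 0 =
      {σ | σ ∈ windingComplex M n w ∧
        ∀ f, σ.HasVertex f → ∃ p : GridPath k l, p.Encodes f ∧ p.Thin} := by
  ext σ
  constructor
  · rintro ⟨a, F, rfl, -, hF⟩
    refine ⟨P.cell_mem_windingComplex _ F, fun f hf => ?_⟩
    obtain ⟨p, hp, rfl⟩ := P.hasVertex_cell_iff.1 hf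
    exact ⟨p, P.encodes_iff.2 ⟨_, rfl⟩, hF p hp⟩
  · rintro ⟨hσ, hthin⟩
    obtain ⟨a, F, rfl⟩ := P.exists_eq_cell_index B hσ
    refine ⟨a, F, rfl, fun p _ t _ j h1 h2 => by omega, fun p hp => ?_⟩
    obtain ⟨p', h1, h2⟩ := hthin _ (P.hasVertex_cell_iff.2 ⟨p, hp, rfl⟩)
    exact P.thin_of_encodes h1 h2

end WindingData

/-! ### The garland of cubes -/

namespace WindingData

open GridFlip SimpleGraph

variable {M n w k l s b : ℕ} [NeZero n] [NeZero M] [NeZero k] [NeZero l]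

theorem isCube_cell_cube (P : WindingData M n w k l) (q i : ℤ) :
    (P.cell q (cube k l (Nat.gcd k l * i))).IsCube (Nat.gcd k l) := by
  classical
  refine ⟨fun x => Finset.card_le_two, ?_⟩
  have hcard : ∀ x : Fin M, ((P.cell q (cube k l (Nat.gcd k l * i))).toFun x).card - 1 =
      if ((k : ℤ) + l) ∣ Nat.gcd k l * i + l * ((x : ℕ) : ℤ) then 1 else 0 := by
    intro x
    have h1 : (P.cell q (cube k l (Nat.gcd k l * i))).toFun x =
      {P.hom q (cube k l (Nat.gcd k l * i)).bot x, P.hom q (cube k l (Nat.gcd k l * i)).top x} := rfl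
    rw [h1, hom_apply, hom_apply]
    split_ifs with h
    · rw [Finset.card_pair]
      have h2 : (cube k l (Nat.gcd k l * i)).bot.y (x : ℕ) =
        (cube k l (Nat.gcd k l * i)).top.y (x : ℕ) - 1 := ofCorners_bot_of_mem h
      intro h3
      have := site_injective P.three_le h3 (by omega) (by omega)
      omega
    · have h2 : (cube k l (Nat.gcd k l * i)).bot.y (x : ℕ) =
        (cube k l (Nat.gcd k l * i)).top.y (x : ℕ) := ofCorners_bot_of_notMem h
      rw [h2, Finset.pair_eq_singleton, Finset.card_singleton]
  rw [Finset.sum_congr rfl fun x _ => hcard x, ← Finset.card_filter]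
  refine Eq.trans ?_
    (card_dvd_add_mul (m := k) (n := l) (c := Nat.gcd k l * i) (Dvd.intro _ rfl))
  have hM : (M : ℤ) = k + l := by exact_mod_cast P.length_eq
  refine Finset.card_bij (fun x _ => ((x : ℕ) : ℤ)) ?_ ?_ ?_
  · intro x hx
    rw [Finset.mem_filter] at hx ⊢
    have := x.2
    exact ⟨Finset.mem_Ico.2 (by omega), hx.2⟩
  · intro x _ y _ h
    exact Fin.ext (by exact_mod_cast h)
  · intro t ht
    rw [Finset.mem_filter, Finset.mem_Ico] at ht
    obtain ⟨x, rfl⟩ := Int.eq_ofNat_of_zero_le ht.1.1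
    exact ⟨⟨x, by omega⟩, Finset.mem_filter.2 ⟨Finset.mem_univ _, ht.2⟩, rfl⟩

/-- The cubes of thin flips form `s` circles of `b * (k + l) / gcd k l` cubes each. -/
theorem isGarland (P : WindingData M n w k l) (B : BandNumber n s b) :
    HomCell.IsGarland {σ | σ ∈ windingComplex M n w ∧
      ∀ f, σ.HasVertex f → ∃ p : GridPath k l, p.Encodes f ∧ p.Thin}
      s (M * n / Nat.gcd k l) (Nat.gcd k l) := by
  have hπ := P.isBandCover B
  have hdpos : 0 < Nat.gcd k l := Nat.gcd_pos_of_pos_left l (NeZero.pos k)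
  have hbpos : 0 < b := by
    have := NeZero.pos n
    rw [← B.mul_eq] at this
    exact Nat.pos_of_mul_pos_left this
  set d := Nat.gcd k l with hd
  obtain ⟨N', hN'⟩ : d ∣ k + l := dvd_add (Nat.gcd_dvd_left k l) (Nat.gcd_dvd_right k l)
  obtain ⟨ℓ, hℓdef⟩ : ∃ ℓ, ℓ = b * N' := ⟨_, rfl⟩
  have hℓ : ℓ * d = b * (k + l) := by rw [hN', hℓdef]; ring
  have hℓ2 : 2 ≤ ℓ := by
    have h1 : d ≤ k := Nat.gcd_le_left l (NeZero.pos k)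
    have h2 : d ≤ l := Nat.gcd_le_right k (NeZero.pos l)
    have h3 : 2 ≤ N' := by
      by_contra h
      have : d * N' ≤ d * 1 := Nat.mul_le_mul_left d (by omega)
      omega
    rw [hℓdef]
    exact h3.trans (Nat.le_mul_of_pos_left N' hbpos)
  -- the cubes and their vertices, as functions on the integers and modulo `ℓ`
  let c : Fin s → ℤ → HomCell (cycleGraph M) (cycleGraph n) :=
    fun a i => P.cell (a : ℕ) (cube k l (d * i))
  let v : Fin s → ℤ → (cycleGraph M →g cycleGraph n) :=
    fun a i => P.hom (a : ℕ) (cube k l (d * i)).bot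
  have hcast : ∀ i : ZMod ℓ, ((i.cast : ℤ) : ZMod ℓ) = i := ZMod.intCast_zmod_cast
  have hc : ∀ a (i j : ℤ), (i : ZMod ℓ) = j → c a i = c a j := by
    intro a i j h
    obtain ⟨e, he⟩ := IsBandCover.exists_shift_cube_gcd hℓ h
    simp only [c]
    rw [← he]
    exact (hπ.shift_eq a _ e).symm
  have hv : ∀ a (i j : ℤ), (i : ZMod ℓ) = j → v a i = v a j := by
    intro a i j h
    obtain ⟨e, he⟩ := IsBandCover.exists_shift_cube_gcd hℓ h
    simp only [v]
    rw [← he]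
    exact (P.hom_shift_band B _ e _).symm
  -- every face of a cube comes from a flip
  have hface : ∀ a i σ, σ ≤ c a i → ∃ a' : Fin s, ∃ F : GridFlip k l, σ = P.cell (a' : ℕ) F := by
    intro a i σ h
    exact P.exists_eq_cell_index B fun f hf =>
      P.cell_mem_windingComplex _ _ f fun x => h x (hf x)
  refine ⟨fun _ => ℓ, fun a i => c a i.cast, fun a i => v a i.cast, fun _ => hℓ2, ?_, ?_, ?_, ?_,
    ?_, ?_, ?_⟩
  · rw [Finset.sum_const, Finset.card_univ, Fintype.card_fin, smul_eq_mul]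
    refine (Nat.div_eq_of_eq_mul_left hdpos ?_).symm
    rw [mul_assoc, hℓ, ← mul_assoc, B.mul_eq, P.length_eq, mul_comm]
  · rw [← P.thinSet_eq B]
    ext σ
    constructor
    · rintro ⟨a, F, rfl, -, hF⟩
      obtain ⟨i, hi⟩ := exists_le_cube hF
      refine ⟨a, (i : ZMod ℓ), ?_⟩
      dsimp only
      rw [hc a _ i (hcast _)]
      exact hπ.le_of_le a hi
    · rintro ⟨a, i, hσ⟩
      obtain ⟨a', F, rfl⟩ := hface _ _ _ hσ
      obtain ⟨rfl, e, he⟩ := (hπ.le_iff _ _ _ _).1 hσ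
      exact ⟨a', F.shift (e * b), hπ.shift_eq _ _ _, fun p _ t _ j h1 h2 => by omega,
        thin_of_le_cube he⟩
  · intro a i
    exact P.isCube_cell_cube _ _
  · intro a i j h
    have := hπ.intCast_eq_of_cube_eq hℓ h
    rwa [hcast, hcast] at this
  · intro a i x
    have h1 : v a (i + 1 : ZMod ℓ).cast = v a (i.cast + 1) := hv _ _ _ (by
      rw [hcast, Int.cast_add, hcast, Int.cast_one])
    have h2 : v a (i.cast + 1) = P.hom (a : ℕ) (cube k l (d * i.cast)).top := by
      simp only [v]
      rw [← cube_bot_add_gcd (Dvd.intro _ rfl), mul_add, mul_one]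
    dsimp only
    rw [h1, h2]
    rfl
  · intro a i j hij σ hi hj
    obtain ⟨a', F, rfl⟩ := hface _ _ _ hi
    have h := hπ.inter_cubes hℓ hi hj
    obtain ⟨rfl, -⟩ := (hπ.le_iff _ _ _ _).1 hi
    rw [hcast, hcast] at h
    rcases h with h | ⟨h, hF⟩ | ⟨h, hF⟩
    · exact absurd h hij
    · exact Or.inl ⟨h, hF.trans (P.cell_single _ _)⟩
    · exact Or.inr ⟨h, hF.trans (P.cell_single _ _)⟩
  · intro a a' haa i j σ hi hj
    obtain ⟨a'', F, rfl⟩ := hface _ _ _ hi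
    exact haa (((hπ.le_iff _ _ _ _).1 hi).1.symm.trans ((hπ.le_iff _ _ _ _).1 hj).1)

end WindingData

theorem corollary8p3 :
    (∀ b m n g : ℕ, 0 < b → 0 < m → 0 < n →
      CollapsesTo (torusFrontComplex b m n g) (thinTorusFrontComplex b m n g)) ∧
    (∀ m n w r : ℕ, 5 ≤ m → 3 ≤ n → n ≠ 4 → m = n * w + 2 * r → 0 < r →
      CollapsesTo (windingComplex m n w) (thinWindingComplex m n w r) ∧
      HomCell.IsGarland (thinWindingComplex m n w r)
        (if Even m ∧ Even n then 2 else 1) (m * n / Nat.gcd m r) (Nat.gcd m r)) := by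
  constructor
  · intro b m n g hb hm hn
    have : NeZero m := ⟨hm.ne'⟩
    have : NeZero n := ⟨hn.ne'⟩
    exact collapsesTo_thinTorusFrontComplex g hb
  · intro m n w r hm hn hn4 hmr hr
    have : NeZero m := ⟨by omega⟩
    have : NeZero n := ⟨by omega⟩
    have : NeZero r := ⟨hr.ne'⟩
    have : NeZero (m - r) := ⟨by omega⟩
    have P : WindingData m n w r (m - r) := ⟨by omega, by omega, by omega, hn, hn4⟩
    have B := bandNumber n
    have heven : (Even m ∧ Even n) ↔ Even n := by
      refine and_iff_right_of_imp fun h => ?_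
      rw [hmr]
      exact (h.mul_right w).add (even_two_mul r)
    have hgcd : Nat.gcd m r = Nat.gcd r (m - r) := by
      rw [Nat.gcd_sub_self_right (by omega), Nat.gcd_comm]
    have hcol := (P.isBandCover B).collapsesTo (b := if Even n then n / 2 else n)
      (by split_ifs <;> omega) 0
    rw [P.legSet_eq B, P.thinSet_eq B] at hcol
    refine ⟨hcol, ?_⟩
    simp only [heven, hgcd]
    exact P.isGarland B
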